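/- **Frameworks.** Fix an infinite set of possible arguments. An argumentation framework (AF) is $F=(A,C)$ with $A$ a finite set of arguments and $C\subseteq A\times A$; $(b,a)\in C$ means that $b$ attacks $a$, $Att(a)=\{b:(b,a)\in C\}$, and the in-degree of $a$ is $|Att(a)|$. A path of length $n\ge 0$ from $x$ to $a$ is a sequence $x=x_0,\dots,x_n=a$ with $(x_i,x_{i+1})\in C$ for $i<n$ (repetitions are allowed); in particular every argument has a path of length $0$ to itself. $Str_F(a)$ is the set consisting of $a$ and all arguments with a path to $a$; $F|_S=(S,C\cap(S\times S))$; $F\oplus F'=(A\cup A',C\cup C')$. An isomorphism is a bijection between the argument sets that preserves and reflects attacks; an automorphism is an isomorphism from an AF to itself. For $R\subseteq C$, $F\ominus R=(A,C\setminus R)$. For $X\subseteq A$ and $y\in A$, $F\ominus_y X$ has arguments $A\setminus(X\setminus\{y\})$ and attacks $C\cap((A\setminus X)\times(A\setminus X))$. $Att^-(X)=\{(y,x)\in C: y\notin X,\ x\in X\}$. **Semantics.** A gradual semantics $\sigma$ assigns to every AF $F=(A,C)$ a function $\sigma_F:A\to[0,1]$. $\mathtt{Hbs}$, $\mathtt{Max}$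 and $\mathtt{Car}$ are given by the unique solutions in $[0,1]$ of $\sigma_F(a)=\frac1{1+G}$ ($a\in A$), where $G$ is respectively $\sum_{b\in Att(a)}\sigma_F(b)$, $\max_{b\in Att(a)}\sigma_F(b)$ and $|Att(a)|+\frac{1}{|Att(a)|}\sum_{b\in Att(a)}\sigma_F(b)$ (in all three cases $G=0$ if $Att(a)=\emptyset$). For a damping factor $\alpha\in(0,1)$ and a normalisation factor $N$, the counting degree vector is $\lim_{k\to\infty}\sum_{i=0}^k(-1)^i\alpha^i(M/N)^i\mathbf 1$, where $M_{ab}=1$ if $b$ attacks $a$ and $M_{ab}=0$ otherwise (and $M/N:=0$ if $N=0$). The counting semantics $\mathtt{CS}$ takes $N=N_F$, the maximum in-degree of $F$, i.e. $\|M\|_\infty$. **Impact measures.** $\mathtt{ImpDV}^\sigma_F(X,y)=\sigma_{F\ominus Att^-(X)}(y)-\sigma_{F\ominus_y X}(y)$; for $\mathtt{CS}$ both degrees are computed with the same normalisation factor $N_F$ of the given $F$. The Shapley measure of an attack $(b,a)$ is $$s((b,a))=\sum_{Z\subseteq Y}\frac{|Z|!\,(n-|Z|-1)!}{n!}\left(\sigma_{F\ominus(Z\cup\{(b,a)\})}(a)-\sigma_{F\ominus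 Z}(a)\right),$$ with $Y=\{(y,a):y\in Att(a)\}\setminus\{(b,a)\}$ and $n=|Att(a)|$ (for $\mathtt{CS}$, each degree is computed with the maximum in-degree of the modified framework). The weight of a path is the product of the Shapley measures of its attacks. $\mathtt{ImpSI}^\sigma_F(\{x\},a)$ is the sum of the weights of all paths of positive even length from $x$ to $a$ minus the sum of the weights of all paths of odd length from $x$ to $a$, and $\mathtt{ImpSI}^\sigma_F(X,a)=\sum_{x\in X}\mathtt{ImpSI}^\sigma_F(\{x\},a)$. (An infinite sum means its value when it converges absolutely; by convention it is $0$ otherwise.) **Principles** for a pair $I=\mathtt{Imp}^\sigma$, where $F=(A,C)$ and $F'=(A',C')$ range over all AFs, $X$ over all subsets of $A$, and $a$ over $A$: 1. *Impact Anonymity*: $I_F(X,a)=I_{F'}(f(X),f(a))$ for every isomorphism $f:F\to F'$. 2. *Impact Independence*: if $A\cap A'=\emptyset$ then $I_F(X,a)=I_{F\oplus F'}(X,a)$. 3. *Balanced Impact*: $I_F(X,a)+I_F(\{x'\},a)=I_F(X\cup\{x'\},a)$ for all $x'\in A\setminus X$. 4. *Void Impact*: $I_F(\emptyset,a)=0$.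 5. *Impact Directionality*: if $b,x\in A$, $F'=(A,C\cup\{(b,x)\})$ and there is no path from $x$ to $a$ in $F$, then $I_F(X,a)=I_{F'}(X,a)$. 6. *Impact Minimisation*: if $x'\in X$ has no path to $a$, then $I_F(X,a)=I_F(X\setminus\{x'\},a)$. 7. *Zero Impact*: if $x\in A$ has no path to $a$, then $I_F(\{x\},a)=0$. 8. *Impact Symmetry*: for $a,b\in A$ and $S=Str_F(a)\cup Str_F(b)$, if $f$ is an automorphism of $F|_S$ with $f(a)=b$ and $f(b)=a$, then $I_F(X,a)=I_F(f(X\cap S),b)$. 9. *Impact Existence*: if $\sigma_F(a)\ne1$, then $I_F(X,a)\neq0$ for some $X\subseteq A$. **Theorem.** Let $\alpha\in(0,1)$ be any damping factor for $\mathtt{CS}$. - For $\sigma\in\{\mathtt{Hbs},\mathtt{Max},\mathtt{Car}\}$: the sums defining $\mathtt{ImpSI}^\sigma$ converge absolutely on every AF, and $\mathtt{ImpSI}^\sigma$ satisfies all nine principles; $\mathtt{ImpDV}^\sigma$ satisfies all of them except Balanced Impact, which it violates. - $\mathtt{ImpDV}^{\mathtt{CS}}$ satisfies Impact Anonymity,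 Void Impact, Impact Minimisation, Zero Impact, Impact Symmetry and Impact Existence, and violates Impact Independence, Balanced Impact and Impact Directionality. - $\mathtt{ImpSI}^{\mathtt{CS}}$ satisfies Impact Anonymity, Balanced Impact, Void Impact, Impact Minimisation, Zero Impact and Impact Symmetry, and violates Impact Independence and Impact Directionality; on the class of AFs that have at least two arguments of maximum in-degree, the sums defining it converge absolutely and it satisfies Impact Existence. -/

import Mathlib

open Set Filter Topology

/-- An argumentation framework over a universe `U` of possible arguments: a finite set of
arguments and a set of attacks between them; `(b, a) ∈ attacks` means that `b` attacks `a`. -/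
@[ext]
structure AF (U : Type*) where
  args : Finset U
  attacks : Finset (U × U)
  left_mem : ∀ e ∈ attacks, e.1 ∈ args
  right_mem : ∀ e ∈ attacks, e.2 ∈ args

namespace AF

variable {U : Type*} [DecidableEq U]

/-- The set `Att(a)` of direct attackers of `a`. -/
def attackers (F : AF U) (a : U) : Finset U :=
  F.args.filter fun b => (b, a) ∈ F.attacks

/-- The set `{(b, a) | b ∈ Att(a)}` of attacks on `a`. -/
def attacksOn (F : AF U) (a : U) : Finset (U × U) :=
  F.attacks.filter fun e => e.2 = a

/-- The union `AS ⊕ AS'` of two frameworks. -/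
def union (F F' : AF U) : AF U where
  args := F.args ∪ F'.args
  attacks := F.attacks ∪ F'.attacks
  left_mem e he := by
    rcases Finset.mem_union.1 he with h | h
    · exact Finset.mem_union_left _ (F.left_mem e h)
    · exact Finset.mem_union_right _ (F'.left_mem e h)
  right_mem e he := by
    rcases Finset.mem_union.1 he with h | h
    · exact Finset.mem_union_left _ (F.right_mem e h)
    · exact Finset.mem_union_right _ (F'.right_mem e h)

/-- The restriction of a framework to the set `X` of arguments (used for `X ⊆ F.args`). -/
def restrict (F : AF U) (X : Finset U) : AF U where
  args := F.args ∩ X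
  attacks := F.attacks.filter fun e => e.1 ∈ X ∧ e.2 ∈ X
  left_mem e he := by
    have h := Finset.mem_filter.1 he
    exact Finset.mem_inter.2 ⟨F.left_mem e h.1, h.2.1⟩
  right_mem e he := by
    have h := Finset.mem_filter.1 he
    exact Finset.mem_inter.2 ⟨F.right_mem e h.1, h.2.2⟩

/-- The framework with one more attack `(b, x)` between existing arguments. -/
def addAttack (F : AF U) (b x : U) (hb : b ∈ F.args) (hx : x ∈ F.args) : AF U where
  args := F.args
  attacks := insert (b, x) F.attacks
  left_mem e he := by
    rcases Finset.mem_insert.1 he with rfl | h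
    · exact hb
    · exact F.left_mem e h
  right_mem e he := by
    rcases Finset.mem_insert.1 he with rfl | h
    · exact hx
    · exact F.right_mem e h

/-- The set of external attackers of `X`. -/
def externalAttackers (F : AF U) (X : Finset U) : Finset U :=
  (F.args \ X).filter fun y => ∃ x ∈ X, (y, x) ∈ F.attacks

/-- The set of external attacks to `X`. -/
def externalAttacks (F : AF U) (X : Finset U) : Finset (U × U) :=
  F.attacks.filter fun e => e.1 ∈ F.externalAttackers X ∧ e.2 ∈ X

/-- Argument deletion: all arguments of `X` other than `y` are deleted, together with all the
attacks from or to an argument of `X` (including `y` when `y ∈ X`). -/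
def deleteArgs (F : AF U) (y : U) (X : Finset U) : AF U where
  args := F.args \ (X \ {y})
  attacks := F.attacks.filter fun e => e.1 ∈ F.args \ X ∧ e.2 ∈ F.args \ X
  left_mem e he := by
    have h := (Finset.mem_filter.1 he).2.1
    simp only [Finset.mem_sdiff] at h ⊢
    exact ⟨h.1, fun h' => h.2 h'.1⟩
  right_mem e he := by
    have h := (Finset.mem_filter.1 he).2.2
    simp only [Finset.mem_sdiff] at h ⊢
    exact ⟨h.1, fun h' => h.2 h'.1⟩

/-- Attack deletion. -/
def deleteAttacks (F : AF U) (R : Finset (U × U)) : AF U where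
  args := F.args
  attacks := F.attacks \ R
  left_mem e he := F.left_mem e (Finset.mem_sdiff.1 he).1
  right_mem e he := F.right_mem e (Finset.mem_sdiff.1 he).1

/-- The paths with `n` attacks from `x` to `a`: sequences `x = p 0, …, p n = a` in which every
member attacks the next one. Arguments may be repeated. -/
def Path (F : AF U) (x a : U) (n : ℕ) : Type _ :=
  {p : Fin (n + 1) → U // p 0 = x ∧ p (Fin.last n) = a ∧
    ∀ i : Fin n, (p i.castSucc, p i.succ) ∈ F.attacks}

/-- There is a path from `x` to `a`; as `n = 0` is allowed, every argument has a path to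
itself. -/
def HasPath (F : AF U) (x a : U) : Prop := ∃ n, Nonempty (F.Path x a n)

open scoped Classical in
/-- The attack structure of `a`. -/
noncomputable def str (F : AF U) (a : U) : Finset U :=
  insert a (F.args.filter fun y => F.HasPath y a)

/-- `f` is an isomorphism from `F` to `F'`. -/
def IsIso (F F' : AF U) (f : U → U) : Prop :=
  Set.BijOn f F.args F'.args ∧
    ∀ a ∈ F.args, ∀ b ∈ F.args, (a, b) ∈ F.attacks ↔ (f a, f b) ∈ F'.attacks

/-- The maximum in-degree of a framework (`0` without arguments), which is the infinity norm of
its attack matrix. -/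
def maxInDegree (F : AF U) : ℕ := F.args.sup fun a => (F.attackers a).card

/-- At least two arguments of `F` have the maximum in-degree. -/
def TwoOfMaxInDegree (F : AF U) : Prop :=
  2 ≤ (F.args.filter fun a => (F.attackers a).card = F.maxInDegree).card

end AF

/-- A gradual semantics: every argument of every framework gets a degree in `[0, 1]`. The value
of `degree F a` for `a ∉ F.args` is meaningless and never used. -/
structure GradualSemantics (U : Type*) where
  degree : AF U → U → ℝ
  degree_mem : ∀ F : AF U, ∀ a ∈ F.args, degree F a ∈ Set.Icc (0 : ℝ) 1

/-! ### The h-categoriser, max-based and card-based semantics -/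

section Fixpoint

variable {U : Type*}

/-- `w` solves the system `w a = 1 / (1 + G w a)`, `a ∈ F.args`, in `[0, 1]`; it is normalised
to be `0` outside `F.args`. -/
def IsSolution (F : AF U) (G : (U → ℝ) → U → ℝ) (w : U → ℝ) : Prop :=
  (∀ a ∈ F.args, w a ∈ Set.Icc (0 : ℝ) 1 ∧ w a = 1 / (1 + G w a)) ∧ ∀ a ∉ F.args, w a = 0

theorem eq_of_scaling {A : Finset U} {G : (U → ℝ) → U → ℝ}
    (h0 : ∀ v, 0 ≤ v → 0 ≤ G v) (hm : ∀ v w, 0 ≤ v → v ≤ w → G v ≤ G w)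
    (hs : ∀ v, 0 ≤ v → ∀ t : ℝ, 0 < t → t ≤ 1 → t • G v ≤ G (t • v))
    {v v' x x' : U → ℝ} (hv : 0 ≤ v) (hv' : 0 ≤ v')
    (hx : (x = v ∧ x' = v') ∨ (x = v' ∧ x' = v))
    (hA : ∀ a ∉ A, v a = 0 ∧ v' a = 0)
    (e : ∀ a ∈ A, v a = 1 / (1 + G x a)) (e' : ∀ a ∈ A, v' a = 1 / (1 + G x' a)) :
    v = v' := by
  have hx0 : 0 ≤ x := by rcases hx with h | h <;> rw [h.1] <;> assumption
  have hx0' : 0 ≤ x' := by rcases hx with h | h <;> rw [h.2] <;> assumption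
  have p : ∀ a ∈ A, 0 < v a := fun a ha => by
    have := h0 x hx0 a
    rw [e a ha]; simp at this; positivity
  have p' : ∀ a ∈ A, 0 < v' a := fun a ha => by
    have := h0 x' hx0' a
    rw [e' a ha]; simp at this; positivity
  by_cases hne : A.Nonempty
  swap
  · funext a
    have : a ∉ A := fun h => hne ⟨a, h⟩
    rw [(hA a this).1, (hA a this).2]
  obtain ⟨c, hc, hmin⟩ := A.exists_min_image (fun a => min (v a / v' a) (v' a / v a)) hne
  set t := min (v c / v' c) (v' c / v c) with ht
  have t0 : 0 < t := lt_min (div_pos (p c hc) (p' c hc)) (div_pos (p' c hc) (p c hc))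
  have r1 : t • v' ≤ v := fun a => by
    by_cases ha : a ∈ A
    · have := (hmin a ha).trans (min_le_left _ _)
      rw [le_div_iff₀ (p' a ha)] at this
      simpa using this
    · simp [hA a ha]
  have r2 : t • v ≤ v' := fun a => by
    by_cases ha : a ∈ A
    · have := (hmin a ha).trans (min_le_right _ _)
      rw [le_div_iff₀ (p a ha)] at this
      simpa using this
    · simp [hA a ha]
  have rx : t • x ≤ x' ∧ t • x' ≤ x := by
    rcases hx with h | h <;> rw [h.1, h.2]
    · exact ⟨r2, r1⟩
    · exact ⟨r1, r2⟩
  have t1 : t ≤ 1 := by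
    rcases le_total (v c) (v' c) with h | h
    · exact (min_le_left _ _).trans ((div_le_one (p' c hc)).2 h)
    · exact (min_le_right _ _).trans ((div_le_one (p c hc)).2 h)
  have g1 : t * G x c ≤ G x' c :=
    (hs x hx0 t t0 t1 c).trans (hm _ _ (smul_nonneg t0.le hx0) rx.1 c)
  have g2 : t * G x' c ≤ G x c :=
    (hs x' hx0' t t0 t1 c).trans (hm _ _ (smul_nonneg t0.le hx0') rx.2 c)
  have q : 0 < 1 + G x c := by have := h0 x hx0 c; simp at this; linarith
  have q' : 0 < 1 + G x' c := by have := h0 x' hx0' c; simp at this; linarith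
  have one_le : 1 ≤ t := by
    rcases min_choice (v c / v' c) (v' c / v c) with h | h
    · have h2 : t = (1 + G x' c) / (1 + G x c) := by
        rw [ht, h, e c hc, e' c hc]; field_simp
      rw [eq_div_iff q.ne'] at h2
      nlinarith
    · have h2 : t = (1 + G x c) / (1 + G x' c) := by
        rw [ht, h, e c hc, e' c hc]; field_simp
      rw [eq_div_iff q'.ne'] at h2
      nlinarith
  have te : t = 1 := le_antisymm t1 one_le
  rw [te, one_smul] at r1 r2
  exact le_antisymm r2 r1

theorem existsUnique_isSolution (F : AF U) {G : (U → ℝ) → U → ℝ}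
    (h0 : ∀ v, 0 ≤ v → 0 ≤ G v) (hm : ∀ v w, 0 ≤ v → v ≤ w → G v ≤ G w)
    (hs : ∀ v, 0 ≤ v → ∀ t : ℝ, 0 < t → t ≤ 1 → t • G v ≤ G (t • v)) :
    ∃! w, IsSolution F G w := by
  classical
  have nn : ∀ {w}, IsSolution F G w → 0 ≤ w := fun {w} hw a => by
    by_cases ha : a ∈ F.args
    · exact (hw.1 a ha).1.1
    · simp [hw.2 a ha]
  have bd : ∀ (w : U → ℝ), 0 ≤ w → ∀ a, 1 / (1 + G w a) ∈ Set.Icc (0 : ℝ) 1 := fun w hw a => by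
    have := h0 w hw a
    simp only [Pi.zero_apply] at this
    exact ⟨by positivity, (div_le_one (by linarith)).2 (by linarith)⟩
  have : ∃ w, IsSolution F G w := by
    let L := U → Set.Icc (0 : ℝ) 1
    let c : L → U → ℝ := fun f a => (f a : ℝ)
    have c0 : ∀ f : L, 0 ≤ c f := fun f a => (f a).2.1
    let T : L → L := fun f a => if a ∈ F.args then ⟨1 / (1 + G (c f) a), bd _ (c0 f) a⟩ else 0
    have Tanti : Antitone T := fun f g hfg a => by
      by_cases ha : a ∈ F.args
      · simp only [T, ha, if_true, ← Subtype.coe_le_coe]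
        have := h0 _ (c0 f) a
        simp only [Pi.zero_apply] at this
        exact one_div_le_one_div_of_le (by linarith)
          (by have := hm _ _ (c0 f) (fun a => hfg a : c f ≤ c g) a; linarith)
      · simp [T, ha]
    let T2 : L →o L := ⟨fun f => T (T f), fun f g h => Tanti (Tanti h)⟩
    have hu : T (T T2.lfp) = T2.lfp := T2.map_lfp
    set u := T2.lfp
    have key : c u = c (T u) := by
      refine eq_of_scaling (A := F.args) h0 hm hs (x := c (T u)) (x' := c u) (c0 _) (c0 _)
        (Or.inr ⟨rfl, rfl⟩) ?_ ?_ ?_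
      · intro a ha
        refine ⟨?_, by simp [c, T, ha]⟩
        rw [← hu]; simp [c, T, ha]
      · intro a ha
        conv_lhs => rw [← hu]
        simp [c, T, ha]
      · intro a ha
        simp [c, T, ha]
    refine ⟨c u, fun a ha => ⟨(u a).2, ?_⟩, fun a ha => ?_⟩
    · conv_lhs => rw [key]
      simp [c, T, ha]
    · rw [key]; simp [c, T, ha]
  obtain ⟨w, hw⟩ := this
  refine ⟨w, hw, fun w' hw' => ?_⟩
  exact eq_of_scaling (A := F.args) h0 hm hs (nn hw') (nn hw) (Or.inl ⟨rfl, rfl⟩)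
    (fun a ha => ⟨hw'.2 a ha, hw.2 a ha⟩) (fun a ha => (hw'.1 a ha).2) (fun a ha => (hw.1 a ha).2)

variable [DecidableEq U]

/-- Sum of the degrees of the attackers. -/
def sumAgg (F : AF U) (w : U → ℝ) (a : U) : ℝ := ∑ b ∈ F.attackers a, w b

/-- Maximum of the degrees of the attackers; the maximum over the empty set is `0`. -/
noncomputable def maxAgg (F : AF U) (w : U → ℝ) (a : U) : ℝ :=
  ⨆ b : {b // b ∈ F.attackers a}, w b

/-- Number of the attackers plus the mean of their degrees; the mean over the empty set
is `0`. -/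
noncomputable def cardAgg (F : AF U) (w : U → ℝ) (a : U) : ℝ :=
  (F.attackers a).card + (∑ b ∈ F.attackers a, w b) / (F.attackers a).card

theorem existsUnique_sum (F : AF U) : ∃! w, IsSolution F (sumAgg F) w := by
  refine existsUnique_isSolution F (fun v hv a => ?_) (fun v w _ h a => ?_)
    (fun v _ t _ _ a => ?_)
  · exact Finset.sum_nonneg fun b _ => hv b
  · exact Finset.sum_le_sum fun b _ => h b
  · simp [sumAgg, Finset.mul_sum]

theorem existsUnique_max (F : AF U) : ∃! w, IsSolution F (maxAgg F) w := by
  refine existsUnique_isSolution F (fun v hv a => ?_) (fun v w _ h a => ?_)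
    (fun v _ t ht _ a => ?_)
  · exact Real.iSup_nonneg fun b => hv b
  · exact ciSup_mono (Set.finite_range _).bddAbove fun b => h b
  · simp only [maxAgg, Pi.smul_apply, smul_eq_mul]
    rw [Real.mul_iSup_of_nonneg ht.le]

theorem existsUnique_card (F : AF U) : ∃! w, IsSolution F (cardAgg F) w := by
  refine existsUnique_isSolution F (fun v hv a => ?_) (fun v w _ h a => ?_)
    (fun v _ t _ ht a => ?_)
  · have : 0 ≤ ∑ b ∈ F.attackers a, v b := Finset.sum_nonneg fun b _ => hv b
    simp only [cardAgg, Pi.zero_apply]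
    positivity
  · have : ∑ b ∈ F.attackers a, v b ≤ ∑ b ∈ F.attackers a, w b :=
      Finset.sum_le_sum fun b _ => h b
    simp only [cardAgg]
    gcongr
  · simp only [cardAgg, Pi.smul_apply, smul_eq_mul, ← Finset.mul_sum, mul_add, mul_div_assoc]
    have : (0 : ℝ) ≤ (F.attackers a).card := by positivity
    nlinarith

variable (U)

/-- The h-categoriser semantics `Hbs`. -/
noncomputable def hCategoriser : GradualSemantics U where
  degree F := (existsUnique_sum F).choose
  degree_mem F a ha := ((existsUnique_sum F).choose_spec.1.1 a ha).1

/-- The max-based semantics `Max`. -/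
noncomputable def maxBased : GradualSemantics U where
  degree F := (existsUnique_max F).choose
  degree_mem F a ha := ((existsUnique_max F).choose_spec.1.1 a ha).1

/-- The card-based semantics `Car`. -/
noncomputable def cardBased : GradualSemantics U where
  degree F := (existsUnique_card F).choose
  degree_mem F a ha := ((existsUnique_card F).choose_spec.1.1 a ha).1

end Fixpoint

/-! ### The counting semantics -/

section Counting

variable {U : Type*} [DecidableEq U]

/-- The attack matrix: the entry at `(a, b)` is `1` if `b` attacks `a`, and `0` otherwise. -/
def attackMatrix (F : AF U) : Matrix {a // a ∈ F.args} {a // a ∈ F.args} ℝ :=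
  Matrix.of fun a b => if ((b : U), (a : U)) ∈ F.attacks then 1 else 0

/-- The vector of the counting model at step `k`, with damping factor `α` and normalisation
factor `N`. (If `N = 0` the normalised matrix is `0`.) -/
noncomputable def countingVector (α N : ℝ) (F : AF U) (k : ℕ) : {a // a ∈ F.args} → ℝ :=
  ∑ i ∈ Finset.range (k + 1),
    ((-1) ^ i * α ^ i) • (((N⁻¹ • attackMatrix F) ^ i).mulVec fun _ => 1)

/-- The degree in the counting model with damping factor `α` and normalisation factor `N`. -/
noncomputable def countingDegree (α N : ℝ) (F : AF U) (a : U) : ℝ :=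
  if h : a ∈ F.args then limUnder atTop fun k => countingVector α N F k ⟨a, h⟩ else 0

theorem attackMatrix_mulVec (F : AF U) (N : ℝ) (v : {a // a ∈ F.args} → ℝ)
    (a : {a // a ∈ F.args}) (hN : (F.maxInDegree : ℝ) ≤ N)
    (hv : ∀ b, v b ∈ Set.Icc (0 : ℝ) 1) :
    (N⁻¹ • attackMatrix F).mulVec v a ∈ Set.Icc (0 : ℝ) 1 := by
  have hN0 : 0 ≤ N := (Nat.cast_nonneg _).trans hN
  have hcard : ((F.attackers a).card : ℝ) ≤ N := by
    refine le_trans ?_ hN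
    exact_mod_cast Finset.le_sup (f := fun a => (F.attackers a).card) a.2
  have hsum : ∑ b : {a // a ∈ F.args}, attackMatrix F a b = (F.attackers a).card := by
    have : ∑ b : {a // a ∈ F.args}, attackMatrix F a b =
        ∑ b ∈ F.args, if (b, (a : U)) ∈ F.attacks then (1 : ℝ) else 0 := by
      rw [← Finset.sum_coe_sort F.args]; rfl
    rw [this, AF.attackers, Finset.card_filter]
    push_cast
    rfl
  have hM : ∀ b, 0 ≤ attackMatrix F a b := fun b => by
    simp only [attackMatrix, Matrix.of_apply]; split_ifs <;> norm_num
  rw [Matrix.smul_mulVec, Pi.smul_apply, smul_eq_mul]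
  have e : (attackMatrix F).mulVec v a = ∑ b, attackMatrix F a b * v b := rfl
  rw [e]
  constructor
  · exact mul_nonneg (inv_nonneg.2 hN0) (Finset.sum_nonneg fun b _ => mul_nonneg (hM b) (hv b).1)
  · have h1 : ∑ b, attackMatrix F a b * v b ≤ N := by
      calc _ ≤ ∑ b, attackMatrix F a b :=
            Finset.sum_le_sum fun b _ => mul_le_of_le_one_right (hM b) (hv b).2
        _ ≤ N := hsum.trans_le hcard
    calc N⁻¹ * _ ≤ N⁻¹ * N := mul_le_mul_of_nonneg_left h1 (inv_nonneg.2 hN0)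
      _ ≤ 1 := inv_mul_le_one

/-- The defining limit of the counting model exists when `N` is at least the maximum
in-degree. -/
theorem tendsto_countingDegree {α N : ℝ} (hα : α ∈ Set.Ioo (0 : ℝ) 1) (F : AF U)
    (hN : (F.maxInDegree : ℝ) ≤ N) {a : U} (ha : a ∈ F.args) :
    Tendsto (fun k => countingVector α N F k ⟨a, ha⟩) atTop (𝓝 (countingDegree α N F a)) := by
  set P := N⁻¹ • attackMatrix F with hP
  have hc : ∀ i b, (P ^ i).mulVec (fun _ => (1 : ℝ)) b ∈ Set.Icc (0 : ℝ) 1 := by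
    intro i
    induction i with
    | zero => intro b; simp
    | succ i ih =>
      intro b
      rw [pow_succ', ← Matrix.mulVec_mulVec]
      exact attackMatrix_mulVec F N _ b hN ih
  have hsummable : Summable fun i : ℕ =>
      ((-1) ^ i * α ^ i) * (P ^ i).mulVec (fun _ => (1 : ℝ)) ⟨a, ha⟩ := by
    refine Summable.of_norm_bounded (summable_geometric_of_lt_one hα.1.le hα.2) fun i => ?_
    rw [norm_mul, norm_mul, norm_pow, norm_pow, norm_neg, norm_one, one_pow, one_mul,
      Real.norm_of_nonneg hα.1.le, Real.norm_of_nonneg (hc i _).1]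
    exact mul_le_of_le_one_right (pow_nonneg hα.1.le i) (hc i _).2
  have h := hsummable.hasSum.tendsto_sum_nat.comp (tendsto_add_atTop_nat 1)
  have h' : Tendsto (fun k => countingVector α N F k ⟨a, ha⟩) atTop
      (𝓝 (∑' i : ℕ, ((-1) ^ i * α ^ i) * (P ^ i).mulVec (fun _ => (1 : ℝ)) ⟨a, ha⟩)) := by
    refine h.congr fun k => ?_
    simp [countingVector, Finset.sum_apply, hP]
  rw [countingDegree, dif_pos ha]
  exact h'.limUnder_eq.symm ▸ h'

theorem countingDegree_mem {α N : ℝ} (hα : α ∈ Set.Ioo (0 : ℝ) 1) (F : AF U)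
    (hN : (F.maxInDegree : ℝ) ≤ N) {a : U} (ha : a ∈ F.args) :
    countingDegree α N F a ∈ Set.Icc (0 : ℝ) 1 := by
  have hv : ∀ k b, countingVector α N F k b ∈ Set.Icc (0 : ℝ) 1 := by
    intro k
    induction k with
    | zero => intro b; simp [countingVector]
    | succ k ih =>
      intro b
      have hrec : countingVector α N F (k + 1) b =
          1 - α * (N⁻¹ • attackMatrix F).mulVec (countingVector α N F k) b := by
        have : (N⁻¹ • attackMatrix F).mulVec (countingVector α N F k) =
            ∑ i ∈ Finset.range (k + 1), ((-1) ^ i * α ^ i) •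
              ((N⁻¹ • attackMatrix F) ^ (i + 1)).mulVec (fun _ => (1 : ℝ)) := by
          rw [countingVector, Matrix.mulVec_sum]
          refine Finset.sum_congr rfl fun i _ => ?_
          rw [Matrix.mulVec_smul, pow_succ', Matrix.mulVec_mulVec]
        rw [this, countingVector, Finset.sum_range_succ']
        simp only [Pi.add_apply, Finset.sum_apply, Pi.smul_apply, smul_eq_mul, pow_zero,
          Matrix.one_mulVec, mul_one, Finset.mul_sum]
        rw [sub_eq_neg_add, ← Finset.sum_neg_distrib]
        congr 1
        refine Finset.sum_congr rfl fun i _ => ?_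
        ring
      have h := attackMatrix_mulVec F N _ b hN ih
      rw [hrec]
      have := hα.1
      have := hα.2
      constructor
      · nlinarith [h.1, h.2]
      · nlinarith [h.1, h.2]
  exact isClosed_Icc.mem_of_tendsto (tendsto_countingDegree hα F hN ha)
    (Eventually.of_forall fun k => hv k _)

variable (U)

/-- The counting semantics `CS` with damping factor `α`: the normalisation factor is the infinity
norm of the attack matrix. -/
noncomputable def countingSemantics (α : Set.Ioo (0 : ℝ) 1) : GradualSemantics U where
  degree F := countingDegree α F.maxInDegree F
  degree_mem F _ ha := countingDegree_mem α.2 F le_rfl ha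

end Counting

/-! ### The two impact measures -/

section Impact

variable {U : Type*} [DecidableEq U]

/-- What an impact measure paired with a gradual semantics provides: the impact `Imp F X a` of
the set `X ⊆ F.args` on the argument `a ∈ F.args` in `F`. -/
abbrev Impact (U : Type*) := AF U → Finset U → U → ℝ

/-- The difference that defines the revised Delobelle–Villata impact of `X` on `y` in `F`, with
degrees taken from `d`. -/
def deletionDiff (d : AF U → U → ℝ) (F : AF U) (X : Finset U) (y : U) : ℝ :=
  d (F.deleteAttacks (F.externalAttacks X)) y - d (F.deleteArgs y X) y

/-- `ImpDV` paired with `σ`. -/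
def impDV (σ : GradualSemantics U) : Impact U := deletionDiff σ.degree

/-- `ImpDV` paired with the counting semantics: the normalisation factor of the given framework
is used in both modified frameworks. -/
noncomputable def impDVCounting (α : Set.Ioo (0 : ℝ) 1) : Impact U :=
  fun F => deletionDiff (countingDegree α F.maxInDegree) F

open scoped Nat in
/-- The extended Shapley measure of the attack `(b, a)`. -/
noncomputable def shapley (σ : GradualSemantics U) (F : AF U) (b a : U) : ℝ :=
  ∑ X ∈ ((F.attacksOn a).erase (b, a)).powerset,
    ((X.card ! * ((F.attackers a).card - X.card - 1)! : ℕ) : ℝ) / ((F.attackers a).card ! : ℕ) *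
      (σ.degree (F.deleteAttacks (insert (b, a) X)) a - σ.degree (F.deleteAttacks X) a)

/-- The product of the Shapley measures of the attacks of a path. -/
noncomputable def pathWeight (σ : GradualSemantics U) (F : AF U) {x a : U} {n : ℕ}
    (p : F.Path x a n) : ℝ :=
  ∏ i : Fin n, shapley σ F (p.1 i.castSucc) (p.1 i.succ)

/-- The paths from `x` to `a` with a positive even number of attacks. -/
abbrev EvenPath (F : AF U) (x a : U) := Σ n : {n : ℕ // Even n ∧ 0 < n}, F.Path x a n

/-- The paths from `x` to `a` with an odd number of attacks. -/
abbrev OddPath (F : AF U) (x a : U) := Σ n : {n : ℕ // Odd n}, F.Path x a n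

/-- Both sums over paths in the Shapley-based impact of a single argument converge
absolutely. -/
def PathSummable (σ : GradualSemantics U) (F : AF U) : Prop :=
  ∀ x ∈ F.args, ∀ a ∈ F.args,
    (Summable fun p : EvenPath F x a => pathWeight σ F p.2) ∧
      Summable fun p : OddPath F x a => pathWeight σ F p.2

/-- The Shapley-based impact of the single argument `x` on `a`. -/
noncomputable def impSISingle (σ : GradualSemantics U) (F : AF U) (x a : U) : ℝ :=
  (∑' p : EvenPath F x a, pathWeight σ F p.2) - ∑' p : OddPath F x a, pathWeight σ F p.2

/-- `ImpSI` paired with `σ`. -/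
noncomputable def impSI (σ : GradualSemantics U) : Impact U :=
  fun F X a => ∑ x ∈ X, impSISingle σ F x a

end Impact

/-! ### The nine principles -/

section Principles

variable {U : Type*} [DecidableEq U]

def ImpactAnonymity (I : Impact U) : Prop :=
  ∀ (F F' : AF U) (f : U → U), F.IsIso F' f →
    ∀ X ⊆ F.args, ∀ a ∈ F.args, I F X a = I F' (X.image f) (f a)

def ImpactIndependence (I : Impact U) : Prop :=
  ∀ F F' : AF U, Disjoint F.args F'.args →
    ∀ X ⊆ F.args, ∀ a ∈ F.args, I F X a = I (F.union F') X a

def BalancedImpact (I : Impact U) : Prop :=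
  ∀ F : AF U, ∀ X ⊆ F.args, ∀ x' ∈ F.args \ X, ∀ a ∈ F.args,
    I F X a + I F {x'} a = I F (X ∪ {x'}) a

def VoidImpact (I : Impact U) : Prop :=
  ∀ F : AF U, ∀ a ∈ F.args, I F ∅ a = 0

def ImpactDirectionality (I : Impact U) : Prop :=
  ∀ (F : AF U) (b x : U) (hb : b ∈ F.args) (hx : x ∈ F.args), ∀ a ∈ F.args,
    ¬ F.HasPath x a → ∀ X ⊆ F.args, I F X a = I (F.addAttack b x hb hx) X a

def ImpactMinimisation (I : Impact U) : Prop :=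
  ∀ F : AF U, ∀ X ⊆ F.args, ∀ a ∈ F.args, ∀ x' ∈ X, ¬ F.HasPath x' a →
    I F X a = I F (X \ {x'}) a

def ZeroImpact (I : Impact U) : Prop :=
  ∀ F : AF U, ∀ a ∈ F.args, ∀ x ∈ F.args, ¬ F.HasPath x a → I F {x} a = 0

def ImpactSymmetry (I : Impact U) : Prop :=
  ∀ F : AF U, ∀ a ∈ F.args, ∀ b ∈ F.args, ∀ f : U → U,
    (F.restrict (F.str a ∪ F.str b)).IsIso (F.restrict (F.str a ∪ F.str b)) f →
    f a = b → f b = a →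
      ∀ X ⊆ F.args, I F X a = I F ((X ∩ (F.str a ∪ F.str b)).image f) b

/-- Impact Existence on the class of the frameworks that satisfy `P`. -/
def ImpactExistenceOn (P : AF U → Prop) (σ : GradualSemantics U) (I : Impact U) : Prop :=
  ∀ F : AF U, P F → ∀ a ∈ F.args, σ.degree F a ≠ 1 → ∃ X ⊆ F.args, I F X a ≠ 0

def ImpactExistence (σ : GradualSemantics U) (I : Impact U) : Prop :=
  ImpactExistenceOn (fun _ => True) σ I

end Principles

/-! The invariance principles all rest on one notion, `AF.LocalIso`: a map that matches attackers
exactly on a set `S` closed under attackers. Isomorphisms, disjoint unions, an added attack off the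
attack structure of `a`, and automorphisms of an attack structure are instances. The fixed-point
semantics see only what lies upstream of an argument, since both degree functions solve the same
system on `S` and solutions are unique (`IsAggregatedBy.localDegree`). Local isomorphisms survive
the deletions in both measures, so the impacts transfer.

The counting degree is local once the normalisation factor is fixed. Anonymity, Symmetry and
Minimisation compare frameworks with equal maximum in-degree, so they hold. Independence and
Directionality fail because an unattacked single attacker has impact `-α / N`
(`CountsSingleAttacker`), and `N` can be raised by an attack that has no path to the target.

For `ImpSI`, efficiency of the Shapley value makes the measures of the attacks on `a` add up to `1 -
σ(a)`. They are nonnegative because losing an attack never lowers the degree of its target: two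
solutions are compared where their ratio (`le_of_scaling`) or, for the counting semantics, their
difference (`countingDegree_mono`) is extreme. Degrees are positive, so these sums are bounded by
some `ρ < 1`. The total weight of paths of length `n` into `a` is then at most `ρ ^ n`, which gives
absolute convergence. Splitting off the first attack yields a recursion: if every single impact on
`a` vanished, so would every Shapley measure on `a`, whence `σ(a) = 1`. For the counting semantics
this needs a normalisation factor unaffected by deleting attacks on one argument, which two
arguments of maximum in-degree guarantee.

For `ImpDV`, Existence is witnessed by the set of all arguments, and Balanced Impact fails on a
chain of four arguments. `ImpSI` is additive by definition. -/

namespace AF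

variable {U : Type*} [DecidableEq U]

/-! ### Attackers and in-degrees after deletions -/

theorem mem_attackers {F : AF U} {a b : U} : b ∈ F.attackers a ↔ (b, a) ∈ F.attacks := by
  simp only [attackers, Finset.mem_filter, and_iff_right_iff_imp]
  exact fun h => F.left_mem _ h

theorem attackers_subset (F : AF U) (a : U) : F.attackers a ⊆ F.args :=
  Finset.filter_subset _ _

theorem mem_attackers_deleteAttacks {F : AF U} {R : Finset (U × U)} {a b : U} :
    b ∈ (F.deleteAttacks R).attackers a ↔ b ∈ F.attackers a ∧ (b, a) ∉ R := by
  simp [mem_attackers, deleteAttacks]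

theorem mem_attackers_deleteArgs {F : AF U} {X : Finset U} {y a b : U} :
    b ∈ (F.deleteArgs y X).attackers a ↔ b ∈ F.attackers a ∧ b ∉ X ∧ a ∉ X := by
  simp only [mem_attackers, deleteArgs, Finset.mem_filter, Finset.mem_sdiff]
  exact ⟨fun h => ⟨h.1, h.2.1.2, h.2.2.2⟩,
    fun h => ⟨h.1, ⟨F.left_mem _ h.1, h.2.1⟩, F.right_mem _ h.1, h.2.2⟩⟩

theorem mem_externalAttacks {F : AF U} {X : Finset U} {a b : U} :
    (b, a) ∈ F.externalAttacks X ↔ (b, a) ∈ F.attacks ∧ b ∉ X ∧ a ∈ X := by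
  simp only [externalAttacks, externalAttackers, Finset.mem_filter, Finset.mem_sdiff]
  exact ⟨fun h => ⟨h.1, h.2.1.1.2, h.2.2⟩,
    fun h => ⟨h.1, ⟨⟨F.left_mem _ h.1, h.2.1⟩, a, h.2.2, h.1⟩, h.2.2⟩⟩

theorem mem_attackers_deleteExternal {F : AF U} {X : Finset U} {a b : U} :
    b ∈ (F.deleteAttacks (F.externalAttacks X)).attackers a ↔
      b ∈ F.attackers a ∧ (a ∈ X → b ∈ X) := by
  rw [mem_attackers_deleteAttacks, mem_externalAttacks, mem_attackers]
  tauto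

theorem mem_attacksOn {F : AF U} {a : U} {e : U × U} :
    e ∈ F.attacksOn a ↔ e ∈ F.attacks ∧ e.2 = a := by
  simp [attacksOn]

theorem attacksOn_eq_image (F : AF U) (a : U) :
    F.attacksOn a = (F.attackers a).image fun b => (b, a) := by
  ext ⟨b, c⟩
  simp only [mem_attacksOn, Finset.mem_image, mem_attackers, Prod.mk.injEq]
  constructor
  · rintro ⟨h, rfl⟩
    exact ⟨b, h, rfl, rfl⟩
  · rintro ⟨b', h, rfl, rfl⟩
    exact ⟨h, rfl⟩

theorem card_attacksOn (F : AF U) (a : U) : (F.attacksOn a).card = (F.attackers a).card := by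
  rw [attacksOn_eq_image, Finset.card_image_of_injective]
  exact fun b c h => (Prod.mk.inj h).1

theorem card_attackers_le_maxInDegree (F : AF U) {a : U} (ha : a ∈ F.args) :
    (F.attackers a).card ≤ F.maxInDegree :=
  Finset.le_sup (f := fun a => (F.attackers a).card) ha

theorem maxInDegree_mono {F F' : AF U} (h : F'.args ⊆ F.args)
    (h' : ∀ a ∈ F'.args, F'.attackers a ⊆ F.attackers a) : F'.maxInDegree ≤ F.maxInDegree :=
  Finset.sup_le fun a ha =>
    (Finset.card_le_card (h' a ha)).trans (F.card_attackers_le_maxInDegree (h ha))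

theorem maxInDegree_deleteAttacks_le (F : AF U) (R : Finset (U × U)) :
    (F.deleteAttacks R).maxInDegree ≤ F.maxInDegree :=
  maxInDegree_mono subset_rfl fun _ _ _ hb => (mem_attackers_deleteAttacks.1 hb).1

theorem maxInDegree_deleteArgs_le (F : AF U) (y : U) (X : Finset U) :
    (F.deleteArgs y X).maxInDegree ≤ F.maxInDegree :=
  maxInDegree_mono Finset.sdiff_subset fun _ _ _ hb => (mem_attackers_deleteArgs.1 hb).1

theorem deleteAttacks_empty (F : AF U) : F.deleteAttacks ∅ = F := by
  ext <;> simp [deleteAttacks]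

/-- `f` embeds the part of `F` induced by `S`, a set that contains all attackers of its members,
into `F'`, and preserves the sets of attackers. -/
structure LocalIso (F F' : AF U) (S : Finset U) (f : U → U) : Prop where
  subset : S ⊆ F.args
  mapsTo : ∀ c ∈ S, f c ∈ F'.args
  injOn : Set.InjOn f S
  closed : ∀ c ∈ S, F.attackers c ⊆ S
  attackers_eq : ∀ c ∈ S, F'.attackers (f c) = (F.attackers c).image f

/-! ### Local isomorphisms under deletions -/

namespace LocalIso

variable {F F' : AF U} {S : Finset U} {f : U → U}

theorem deleteExternal (h : LocalIso F F' S f) {X X' : Finset U}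
    (hX : ∀ c ∈ S, f c ∈ X' ↔ c ∈ X) :
    LocalIso (F.deleteAttacks (F.externalAttacks X)) (F'.deleteAttacks (F'.externalAttacks X'))
      S f where
  subset := h.subset
  mapsTo := h.mapsTo
  injOn := h.injOn
  closed c hc b hb := h.closed c hc (mem_attackers_deleteExternal.1 hb).1
  attackers_eq c hc := by
    ext b
    simp only [mem_attackers_deleteExternal, h.attackers_eq c hc, Finset.mem_image, hX c hc]
    constructor
    · rintro ⟨⟨b, hb, rfl⟩, h'⟩
      exact ⟨b, ⟨hb, fun h2 => (hX b (h.closed c hc hb)).1 (h' h2)⟩, rfl⟩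
    · rintro ⟨b, ⟨hb, h'⟩, rfl⟩
      exact ⟨⟨b, hb, rfl⟩, fun h2 => (hX b (h.closed c hc hb)).2 (h' h2)⟩

/-- Deletion keeps `y` as an argument even when `y ∈ X`, hence the set `S \ (X \ {y})`. -/
theorem deleteArgs (h : LocalIso F F' S f) {X X' : Finset U}
    (hX : ∀ c ∈ S, f c ∈ X' ↔ c ∈ X) {y : U} (hy : y ∈ S) :
    LocalIso (F.deleteArgs y X) (F'.deleteArgs (f y) X') (S \ (X \ {y})) f where
  subset := Finset.sdiff_subset_sdiff h.subset subset_rfl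
  mapsTo c hc := by
    simp only [AF.deleteArgs, Finset.mem_sdiff, Finset.mem_singleton] at hc ⊢
    refine ⟨h.mapsTo c hc.1, fun h' => hc.2 ⟨(hX c hc.1).1 h'.1, ?_⟩⟩
    rintro rfl
    exact h'.2 rfl
  injOn := h.injOn.mono fun c hc => (Finset.mem_sdiff.1 hc).1
  closed c hc b hb := by
    have hb := mem_attackers_deleteArgs.1 hb
    exact Finset.mem_sdiff.2 ⟨h.closed c (Finset.mem_sdiff.1 hc).1 hb.1,
      fun h' => hb.2.1 (Finset.mem_sdiff.1 h').1⟩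
  attackers_eq c hc := by
    have hc := (Finset.mem_sdiff.1 hc).1
    ext b
    simp only [mem_attackers_deleteArgs, h.attackers_eq c hc, Finset.mem_image, hX c hc]
    constructor
    · rintro ⟨⟨b, hb, rfl⟩, h1, h2⟩
      exact ⟨b, ⟨hb, fun h3 => h1 ((hX b (h.closed c hc hb)).2 h3), h2⟩, rfl⟩
    · rintro ⟨b, ⟨hb, h1, h2⟩, rfl⟩
      exact ⟨⟨b, hb, rfl⟩, fun h3 => h1 ((hX b (h.closed c hc hb)).1 h3), h2⟩

theorem attacksOn_eq (h : LocalIso F F' S f) {a : U} (ha : a ∈ S) :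
    F'.attacksOn (f a) = (F.attacksOn a).image (Prod.map f f) := by
  rw [attacksOn_eq_image, attacksOn_eq_image, h.attackers_eq a ha, Finset.image_image,
    Finset.image_image]
  rfl

theorem card_attackers (h : LocalIso F F' S f) {a : U} (ha : a ∈ S) :
    (F'.attackers (f a)).card = (F.attackers a).card := by
  rw [h.attackers_eq a ha, Finset.card_image_of_injOn (h.injOn.mono (h.closed a ha))]

theorem injOn_prodMap (h : LocalIso F F' S f) :
    Set.InjOn (Prod.map f f) (S ×ˢ S : Finset (U × U)) := by
  rintro ⟨b, a⟩ h1 ⟨b', a'⟩ h2 h3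
  simp only [Finset.coe_product, Set.mem_prod, Finset.mem_coe, Prod.map_apply,
    Prod.mk.injEq] at h1 h2 h3
  rw [h.injOn h1.1 h2.1 h3.1, h.injOn h1.2 h2.2 h3.2]

theorem attacksOn_subset (h : LocalIso F F' S f) {a : U} (ha : a ∈ S) :
    F.attacksOn a ⊆ S ×ˢ S := by
  rintro ⟨b, c⟩ hb
  obtain ⟨h1, rfl⟩ := mem_attacksOn.1 hb
  exact Finset.mem_product.2 ⟨h.closed _ ha (mem_attackers.2 h1), ha⟩

theorem deleteAttacks (h : LocalIso F F' S f) {Z : Finset (U × U)} (hZ : Z ⊆ S ×ˢ S) :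
    LocalIso (F.deleteAttacks Z) (F'.deleteAttacks (Z.image (Prod.map f f))) S f where
  subset := h.subset
  mapsTo := h.mapsTo
  injOn := h.injOn
  closed c hc b hb := h.closed c hc (mem_attackers_deleteAttacks.1 hb).1
  attackers_eq c hc := by
    -- As `f` is injective on `S` only, a pair can be recovered from its image only because `Z` lies
    -- in `S ×ˢ S`.
    have key : ∀ b ∈ S, (f b, f c) ∈ Z.image (Prod.map f f) ↔ (b, c) ∈ Z := fun b hb => by
      refine ⟨fun h' => ?_, fun h' => Finset.mem_image_of_mem _ h'⟩
      obtain ⟨e, he, h2⟩ := Finset.mem_image.1 h'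
      rw [← h.injOn_prodMap (hZ he) (Finset.mem_product.2 ⟨hb, hc⟩ : (b, c) ∈ S ×ˢ S) h2]
      exact he
    ext b
    simp only [mem_attackers_deleteAttacks, h.attackers_eq c hc, Finset.mem_image (s := F.attackers c),
      Finset.mem_image (s := (F.deleteAttacks Z).attackers c)]
    constructor
    · rintro ⟨⟨b, hb, rfl⟩, h'⟩
      exact ⟨b, ⟨hb, fun h2 => h' ((key b (h.closed c hc hb)).2 h2)⟩, rfl⟩
    · rintro ⟨b, ⟨hb, h'⟩, rfl⟩
      exact ⟨⟨b, hb, rfl⟩, fun h2 => h' ((key b (h.closed c hc hb)).1 h2)⟩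

/-- Corresponding parts outside of `S` make the maximum in-degrees agree. -/
theorem maxInDegree_eq (h : LocalIso F F' S f) (hS : F.args \ S = F'.args \ S.image f)
    (hd : ∀ c ∈ F.args \ S, F'.attackers c = F.attackers c) :
    F.maxInDegree = F'.maxInDegree := by
  have e1 : F.args = F.args \ S ∪ S := (Finset.sdiff_union_of_subset h.subset).symm
  have e2 : F'.args = F.args \ S ∪ S.image f := by
    rw [hS, Finset.sdiff_union_of_subset]
    exact Finset.image_subset_iff.2 h.mapsTo
  unfold maxInDegree
  rw [e2]
  conv_lhs => rw [e1]
  rw [Finset.sup_union, Finset.sup_union, Finset.sup_image]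
  congr 1
  · exact Finset.sup_congr rfl fun c hc => by rw [hd c hc]
  · exact Finset.sup_congr rfl fun c hc => (h.card_attackers hc).symm

/-- Walk the path backwards from its end: each predecessor is an attacker of a member of `S`. -/
theorem mem_of_path (h : ∀ c ∈ S, F.attackers c ⊆ S) {x a : U} {n : ℕ} (p : F.Path x a n)
    (ha : a ∈ S) (i : Fin (n + 1)) : p.1 i ∈ S := by
  induction i using Fin.reverseInduction with
  | last => rw [p.2.2.1]; exact ha
  | cast i ih => exact h _ ih (mem_attackers.2 (p.2.2.2 i))

end LocalIso

/-! ### Paths and attack structures -/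

theorem not_hasPath_of_closed {F : AF U} {S : Finset U} (h : ∀ c ∈ S, F.attackers c ⊆ S) {x a : U}
    (ha : a ∈ S) (hx : x ∉ S) : ¬ F.HasPath x a := by
  rintro ⟨n, ⟨p⟩⟩
  exact hx (p.2.1 ▸ LocalIso.mem_of_path h p ha 0)

omit [DecidableEq U] in
theorem hasPath_refl (F : AF U) (a : U) : F.HasPath a a :=
  ⟨0, ⟨⟨fun _ => a, rfl, rfl, fun i => i.elim0⟩⟩⟩

/-- A path that starts with the attack `(x, y)`. -/
def Path.cons {F : AF U} {x y a : U} {n : ℕ} (h : (x, y) ∈ F.attacks) (p : F.Path y a n) :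
    F.Path x a (n + 1) :=
  ⟨Fin.cons x p.1, rfl, by rw [← Fin.succ_last, Fin.cons_succ]; exact p.2.2.1, fun i => by
    refine Fin.cases ?_ (fun i => ?_) i
    · simpa [p.2.1] using h
    · rw [← Fin.succ_castSucc, Fin.cons_succ, Fin.cons_succ]
      exact p.2.2.2 i⟩

omit [DecidableEq U] in
theorem HasPath.cons {F : AF U} {x y a : U} (h : (x, y) ∈ F.attacks) (h' : F.HasPath y a) :
    F.HasPath x a := by
  obtain ⟨n, ⟨p⟩⟩ := h'
  exact ⟨n + 1, ⟨p.cons h⟩⟩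

theorem mem_str {F : AF U} {a y : U} (ha : a ∈ F.args) :
    y ∈ F.str a ↔ y ∈ F.args ∧ F.HasPath y a := by
  simp only [str, Finset.mem_insert, Finset.mem_filter, or_iff_right_iff_imp]
  rintro rfl
  exact ⟨ha, F.hasPath_refl _⟩

theorem self_mem_str (F : AF U) (a : U) : a ∈ F.str a := Finset.mem_insert_self _ _

theorem str_subset {F : AF U} {a : U} (ha : a ∈ F.args) : F.str a ⊆ F.args :=
  fun _ h => ((mem_str ha).1 h).1

theorem str_closed {F : AF U} {a : U} (ha : a ∈ F.args) : ∀ c ∈ F.str a, F.attackers c ⊆ F.str a :=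
  fun _ hc _ hb => (mem_str ha).2
    ⟨F.attackers_subset _ hb, ((mem_str ha).1 hc).2.cons (mem_attackers.1 hb)⟩

/-! ### Instances of local isomorphisms and their action on paths -/

namespace LocalIso

variable {F F' : AF U} {S : Finset U} {f : U → U}

theorem refl (hS : S ⊆ F.args) (h : ∀ c ∈ S, F.attackers c ⊆ S) : LocalIso F F S id where
  subset := hS
  mapsTo := hS
  injOn := Set.injOn_id _
  closed := h
  attackers_eq := by simp

theorem ofIsIso (h : F.IsIso F' f) : LocalIso F F' F.args f where
  subset := subset_rfl
  mapsTo c hc := h.1.mapsTo hc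
  injOn := h.1.injOn
  closed c _ := F.attackers_subset c
  attackers_eq c hc := by
    ext b
    simp only [Finset.mem_image, mem_attackers]
    constructor
    · intro hb
      obtain ⟨b, hb', rfl⟩ := h.1.surjOn (F'.left_mem _ hb)
      exact ⟨b, (h.2 b hb' c hc).2 hb, rfl⟩
    · rintro ⟨b, hb, rfl⟩
      exact (h.2 b (F.left_mem _ hb) c hc).1 hb

theorem union (h : Disjoint F.args F'.args) : LocalIso F (F.union F') F.args id where
  subset := subset_rfl
  mapsTo c hc := Finset.mem_union_left _ hc
  injOn := Set.injOn_id _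
  closed c _ := F.attackers_subset c
  attackers_eq c hc := by
    ext b
    simp only [Finset.image_id, mem_attackers, AF.union, Finset.mem_union, id,
      or_iff_left_iff_imp]
    exact fun h' => absurd (F'.right_mem _ h') (Finset.disjoint_left.1 h hc)

/-- The target `x` of the new attack is not upstream of `a`, so no member of the attack structure of
`a` gains an attacker. -/
theorem addAttack {a b x : U} (hb : b ∈ F.args) (hx : x ∈ F.args) (ha : a ∈ F.args)
    (h : ¬ F.HasPath x a) : LocalIso F (F.addAttack b x hb hx) (F.str a) id where
  subset := str_subset ha
  mapsTo c hc := str_subset ha hc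
  injOn := Set.injOn_id _
  closed := str_closed ha
  attackers_eq c hc := by
    ext d
    simp only [Finset.image_id, mem_attackers, AF.addAttack, Finset.mem_insert, id,
      or_iff_right_iff_imp, Prod.mk.injEq]
    rintro ⟨rfl, rfl⟩
    exact absurd ((mem_str ha).1 hc).2 h

/-- Closedness of `S` makes the attackers in the restriction all the attackers in `F`, so an
automorphism of the part is a local isomorphism of the whole. -/
theorem ofRestrict (hS : S ⊆ F.args) (hc : ∀ c ∈ S, F.attackers c ⊆ S)
    (h : (F.restrict S).IsIso (F.restrict S) f) : LocalIso F F S f := by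
  have hargs : (F.restrict S).args = S := Finset.inter_eq_right.2 hS
  have hatt : ∀ c ∈ S, (F.restrict S).attackers c = F.attackers c := fun c hcS => by
    ext b
    simp only [mem_attackers, restrict, Finset.mem_filter, and_iff_left_iff_imp]
    exact fun hb => ⟨hc c hcS (mem_attackers.2 hb), hcS⟩
  have h1 := LocalIso.ofIsIso h
  rw [hargs] at h1
  have hm : ∀ c ∈ S, f c ∈ S := fun c hc => by
    have := h1.mapsTo c hc
    rwa [hargs] at this
  exact ⟨hS, fun c hc => hS (hm c hc), h1.injOn, hc, fun c hc => by
    rw [← hatt c hc, ← hatt _ (hm c hc), h1.attackers_eq c hc]⟩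

/-- Composition with `f` maps paths to paths. -/
def mapPath (h : LocalIso F F' S f) {x a : U} (ha : a ∈ S) (n : ℕ) (p : F.Path x a n) :
    F'.Path (f x) (f a) n :=
  ⟨f ∘ p.1, congrArg f p.2.1, congrArg f p.2.2.1, fun i => by
    rw [← mem_attackers, Function.comp, Function.comp,
      h.attackers_eq _ (mem_of_path h.closed p ha _)]
    exact Finset.mem_image_of_mem f (mem_attackers.2 (p.2.2.2 i))⟩

theorem image_closed (h : LocalIso F F' S f) :
    ∀ c ∈ S.image f, F'.attackers c ⊆ S.image f := by
  intro c' hc'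
  obtain ⟨c, hc, rfl⟩ := Finset.mem_image.1 hc'
  rw [h.attackers_eq c hc]
  exact Finset.image_subset_image (h.closed c hc)

theorem mapPath_bijective (h : LocalIso F F' S f) {x a : U} (hx : x ∈ S) (ha : a ∈ S) (n : ℕ) :
    Function.Bijective (h.mapPath (x := x) ha n) := by
  constructor
  · intro p q hpq
    refine Subtype.ext (funext fun i => h.injOn (mem_of_path h.closed p ha i)
      (mem_of_path h.closed q ha i) ?_)
    exact congrFun (congrArg Subtype.val hpq) i
  · intro q
    -- The image of `S` is closed under attackers too, so the path can be lifted vertex by vertex;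
    -- injectivity on `S` turns the lifted vertices into a path.
    have hq : ∀ i, ∃ c ∈ S, f c = q.1 i := fun i => Finset.mem_image.1
      (mem_of_path h.image_closed q (Finset.mem_image_of_mem f ha) i)
    choose p hp hpq using hq
    refine ⟨⟨p, h.injOn (hp _) hx ((hpq _).trans q.2.1),
      h.injOn (hp _) ha ((hpq _).trans q.2.2.1), fun i => ?_⟩, Subtype.ext (funext hpq)⟩
    have := mem_attackers.2 (q.2.2.2 i)
    rw [← hpq, ← hpq, h.attackers_eq _ (hp _)] at this
    obtain ⟨c, hc, hcp⟩ := Finset.mem_image.1 this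
    rw [← h.injOn (h.closed _ (hp _) hc) (hp _) hcp]
    exact mem_attackers.1 hc

end LocalIso

end AF

/-! ### Transfer of degrees and impacts along local isomorphisms -/

section Transfer

variable {U : Type*} [DecidableEq U]

/-- The degree `d F c` depends only on the attackers of `c`, their attackers, and so on. -/
def LocalDegree (d : AF U → U → ℝ) : Prop :=
  ∀ (F F' : AF U) (S : Finset U) (f : U → U), F.LocalIso F' S f → ∀ c ∈ S, d F' (f c) = d F c

/-- As `LocalDegree`, but the degree may also depend on the maximum in-degree. -/
def LocalDegreeUpToMax (d : AF U → U → ℝ) : Prop :=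
  ∀ (F F' : AF U) (S : Finset U) (f : U → U), F.LocalIso F' S f →
    F.maxInDegree = F'.maxInDegree → ∀ c ∈ S, d F' (f c) = d F c

theorem LocalDegree.upToMax {d : AF U → U → ℝ} (hd : LocalDegree d) : LocalDegreeUpToMax d :=
  fun F F' S f h _ => hd F F' S f h

variable {F F' : AF U} {S : Finset U} {f : U → U}

theorem mem_sdiff_sdiff_singleton_self {y : U} {X : Finset U} (hy : y ∈ S) :
    y ∈ S \ (X \ {y}) := by
  simp [hy]

theorem LocalDegree.deletionDiff_eq {d : AF U → U → ℝ} (hd : LocalDegree d)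
    (h : F.LocalIso F' S f) {X X' : Finset U} (hX : ∀ c ∈ S, f c ∈ X' ↔ c ∈ X) {y : U}
    (hy : y ∈ S) : deletionDiff d F' X' (f y) = deletionDiff d F X y := by
  unfold deletionDiff
  rw [hd _ _ _ _ (h.deleteExternal hX) y hy,
    hd _ _ _ _ (h.deleteArgs hX hy) y (mem_sdiff_sdiff_singleton_self hy)]

theorem deletionDiff_empty (d : AF U → U → ℝ) (F : AF U) (y : U) : deletionDiff d F ∅ y = 0 := by
  have : F.deleteAttacks (F.externalAttacks ∅) = F.deleteArgs y ∅ := by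
    ext e
    · simp [AF.deleteAttacks, AF.deleteArgs]
    · simp only [AF.deleteAttacks, AF.externalAttacks, AF.deleteArgs, Finset.mem_sdiff,
        Finset.mem_filter, Finset.notMem_empty, and_false, not_false_eq_true, and_true,
        iff_self_and]
      exact fun h => ⟨F.left_mem _ h, F.right_mem _ h⟩
  rw [deletionDiff, this, sub_self]

/-! ### Deletion-based impact -/

section Deletion

variable {I : Impact U} {d : ℕ → AF U → U → ℝ}

/-- The index of `d` is the normalisation factor: a constant family serves the fixed-point
semantics, and `countingDegree α N` serves the counting semantics. -/
theorem impactAnonymity_of_deletionDiff (hI : ∀ F, I F = deletionDiff (d F.maxInDegree) F)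
    (hd : ∀ N, LocalDegree (d N)) : ImpactAnonymity I := by
  intro F F' f hf X hX a ha
  have h := AF.LocalIso.ofIsIso hf
  have hi : F.args.image f = F'.args := by
    rw [← Finset.coe_inj, Finset.coe_image, hf.1.image_eq]
  have hN : F.maxInDegree = F'.maxInDegree := h.maxInDegree_eq (by simp [hi]) (by simp)
  rw [hI, hI, ← hN, (hd _).deletionDiff_eq h (fun c hc => ?_) ha]
  simp only [Finset.mem_image]
  exact ⟨fun ⟨x, hx, hxc⟩ => h.injOn (hX hx) hc hxc ▸ hx, fun hx => ⟨c, hx, rfl⟩⟩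

/-- The identity on the attack structure of `a` is a local isomorphism from `F` to itself, and `X`
and `X \ {x'}` have the same trace there. The framework, hence the normalisation factor, is
unchanged. -/
theorem impactMinimisation_of_deletionDiff (hI : ∀ F, I F = deletionDiff (d F.maxInDegree) F)
    (hd : ∀ N, LocalDegree (d N)) : ImpactMinimisation I := by
  intro F X _ a ha x' _ hp
  rw [hI]
  refine ((hd _).deletionDiff_eq (.refl (AF.str_subset ha) (AF.str_closed ha)) (fun c hc => ?_)
    (F.self_mem_str a)).symm
  have : c ≠ x' := by
    rintro rfl
    exact hp ((AF.mem_str ha).1 hc).2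
  simp [this]

theorem zeroImpact_of_minimisation (hv : VoidImpact I) (hm : ImpactMinimisation I) :
    ZeroImpact I := fun F a ha x hx hp => by
  rw [hm F {x} (by simpa using hx) a ha x (Finset.mem_singleton_self x) hp, Finset.sdiff_self]
  exact hv F a ha

end Deletion

theorem AF.str_union_closed {a b : U} (ha : a ∈ F.args) (hb : b ∈ F.args) :
    ∀ c ∈ F.str a ∪ F.str b, F.attackers c ⊆ F.str a ∪ F.str b := fun c hc =>
  (Finset.mem_union.1 hc).elim
    (fun h => (AF.str_closed ha c h).trans Finset.subset_union_left)
    (fun h => (AF.str_closed hb c h).trans Finset.subset_union_right)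

theorem mem_image_inter_iff (hf : Set.InjOn f S) {X : Finset U} {c : U} (hc : c ∈ S) :
    f c ∈ (X ∩ S).image f ↔ c ∈ X := by
  simp only [Finset.mem_image, Finset.mem_inter]
  exact ⟨fun ⟨x, hx, hxc⟩ => hf hx.2 hc hxc ▸ hx.1, fun h => ⟨c, ⟨h, hc⟩, rfl⟩⟩

theorem impactSymmetry_of_deletionDiff {I : Impact U} {d : ℕ → AF U → U → ℝ}
    (hI : ∀ F, I F = deletionDiff (d F.maxInDegree) F)
    (hd : ∀ N, LocalDegree (d N)) : ImpactSymmetry I := by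
  rintro F a ha b hb f hf rfl _ X _
  have h := AF.LocalIso.ofRestrict (Finset.union_subset (AF.str_subset ha) (AF.str_subset hb))
    (AF.str_union_closed ha hb) hf
  rw [hI]
  exact ((hd _).deletionDiff_eq h (fun c hc => mem_image_inter_iff h.injOn hc)
    (Finset.mem_union_left _ (F.self_mem_str a))).symm

theorem impactIndependence_impDV {σ : GradualSemantics U} (hd : LocalDegree σ.degree) :
    ImpactIndependence (impDV σ) := fun _ _ hF _ _ _ ha =>
  (hd.deletionDiff_eq (.union hF) (fun _ _ => Iff.rfl) ha).symm

theorem impactDirectionality_impDV {σ : GradualSemantics U} (hd : LocalDegree σ.degree) :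
    ImpactDirectionality (impDV σ) := fun F _ _ hb hx a ha hp _ _ =>
  (hd.deletionDiff_eq (.addAttack hb hx ha hp) (fun _ _ => Iff.rfl) (F.self_mem_str a)).symm

/-- Take `X` to be all arguments: no attack is external, while deleting `X` strips `a` of its
attackers, so the impact is the degree of `a` minus `1`. -/
theorem impactExistence_of_deletionDiff {σ : GradualSemantics U} {I : Impact U}
    {d : ℕ → AF U → U → ℝ} (hI : ∀ F, I F = deletionDiff (d F.maxInDegree) F)
    (hσ : ∀ F, σ.degree F = d F.maxInDegree F)
    (h1 : ∀ N F, F.maxInDegree ≤ N → ∀ a ∈ F.args, F.attackers a = ∅ → d N F a = 1) : ImpactExistence σ I := by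
  intro F _ a ha hne
  refine ⟨F.args, subset_rfl, ?_⟩
  have e : F.deleteAttacks (F.externalAttacks F.args) = F := by
    have : F.externalAttacks F.args = ∅ := by
      simp [AF.externalAttacks, AF.externalAttackers]
    rw [this, AF.deleteAttacks_empty]
  rw [hI, deletionDiff, e, h1 _ (F.deleteArgs a F.args)
    (F.maxInDegree_deleteArgs_le _ _) a (mem_sdiff_sdiff_singleton_self ha),
    ← hσ]
  · exact sub_ne_zero.2 hne
  · refine Finset.eq_empty_of_forall_notMem fun b hb => ?_
    exact (AF.mem_attackers_deleteArgs.1 hb).2.2 ha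

/-! ### Shapley-based impact -/

/-- The deletion of corresponding attacks on corresponding arguments yields the same degree. -/
def ShapleyCompatible (σ : GradualSemantics U) (F F' : AF U) (S : Finset U) (f : U → U) : Prop :=
  ∀ a ∈ S, ∀ Z ⊆ F.attacksOn a,
    σ.degree (F'.deleteAttacks (Z.image (Prod.map f f))) (f a) = σ.degree (F.deleteAttacks Z) a

theorem LocalDegree.shapleyCompatible {σ : GradualSemantics U} (hd : LocalDegree σ.degree)
    (h : F.LocalIso F' S f) : ShapleyCompatible σ F F' S f := fun a ha _ hZ =>
  hd _ _ _ _ (h.deleteAttacks (hZ.trans (h.attacksOn_subset ha))) a ha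

/-- The degrees in the Shapley measure are normalised after the deletion, so the maximum in-degrees
must agree there as well. The deleted attacks have their targets in `S` and in its image, which
leaves the common complement untouched. -/
theorem LocalDegreeUpToMax.shapleyCompatible {σ : GradualSemantics U}
    (hd : LocalDegreeUpToMax σ.degree) (h : F.LocalIso F' S f)
    (hS : F.args \ S = F'.args \ S.image f)
    (hatt : ∀ c ∈ F.args \ S, F'.attackers c = F.attackers c) :
    ShapleyCompatible σ F F' S f := fun a ha Z hZ => by
  have hZS := hZ.trans (h.attacksOn_subset ha)
  refine hd _ _ _ _ (h.deleteAttacks hZS) ?_ a ha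
  refine (h.deleteAttacks hZS).maxInDegree_eq hS fun c hc => ?_
  have hc1 : c ∉ S := (Finset.mem_sdiff.1 hc).2
  have hc2 : c ∉ S.image f := (Finset.mem_sdiff.1 (hS ▸ hc)).2
  ext b
  rw [AF.mem_attackers_deleteAttacks, AF.mem_attackers_deleteAttacks, hatt c hc]
  refine and_congr_right fun _ => iff_of_true (fun h' => hc2 ?_) fun h' => hc1 ?_
  · obtain ⟨e, he, h2⟩ := Finset.mem_image.1 h'
    exact Finset.mem_image.2 ⟨e.2, (Finset.mem_product.1 (hZS he)).2, congrArg Prod.snd h2⟩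
  · exact (Finset.mem_product.1 (hZS h')).2

namespace ShapleyCompatible

variable {σ : GradualSemantics U}

theorem shapley_eq (hσ : ShapleyCompatible σ F F' S f) (h : F.LocalIso F' S f) {a b : U}
    (ha : a ∈ S) (hb : b ∈ F.attackers a) : shapley σ F' (f b) (f a) = shapley σ F b a := by
  have hbS := h.closed a ha hb
  have hba : (b, a) ∈ F.attacksOn a := AF.mem_attacksOn.2 ⟨AF.mem_attackers.1 hb, rfl⟩
  have hsub := h.attacksOn_subset ha
  have e : (F'.attacksOn (f a)).erase (f b, f a) =
      ((F.attacksOn a).erase (b, a)).image (Prod.map f f) := by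
    rw [h.attacksOn_eq ha]
    ext e
    simp only [Finset.mem_erase, Finset.mem_image]
    constructor
    · rintro ⟨h1, e, he, rfl⟩
      refine ⟨e, ⟨?_, he⟩, rfl⟩
      rintro rfl
      exact h1 rfl
    · rintro ⟨e, ⟨h1, he⟩, rfl⟩
      refine ⟨fun h2 => h1 ?_, e, he, rfl⟩
      exact h.injOn_prodMap (hsub he) (hsub hba) h2
  have sub : ∀ Z ∈ ((F.attacksOn a).erase (b, a)).powerset, Z ⊆ F.attacksOn a := fun Z hZ =>
    (Finset.mem_powerset.1 hZ).trans (Finset.erase_subset _ _)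
  unfold shapley
  rw [e, Finset.powerset_image, Finset.sum_image]
  · refine Finset.sum_congr rfl fun Z hZ => ?_
    have hZ := sub Z hZ
    rw [Finset.card_image_of_injOn (h.injOn_prodMap.mono (hZ.trans hsub)), h.card_attackers ha,
      hσ a ha Z hZ, ← hσ a ha _ (Finset.insert_subset hba hZ), Finset.image_insert]
    rfl
  · intro Z hZ Z' hZ' hZZ
    have := congrArg (fun s : Finset (U × U) => (s : Set (U × U))) hZZ
    simp only [Finset.coe_image] at this
    refine Finset.coe_inj.1 ((h.injOn_prodMap.image_eq_image_iff ?_ ?_).1 this)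
    · exact_mod_cast (sub Z hZ).trans hsub
    · exact_mod_cast (sub Z' hZ').trans hsub

theorem pathWeight_mapPath (hσ : ShapleyCompatible σ F F' S f) (h : F.LocalIso F' S f) {x a : U}
    (ha : a ∈ S) {n : ℕ} (p : F.Path x a n) :
    pathWeight σ F' (h.mapPath ha n p) = pathWeight σ F p :=
  Finset.prod_congr rfl fun i _ => hσ.shapley_eq h (AF.LocalIso.mem_of_path h.closed p ha _)
    (AF.mem_attackers.2 (p.2.2.2 i))

theorem impSISingle_eq (hσ : ShapleyCompatible σ F F' S f) (h : F.LocalIso F' S f) {x a : U}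
    (hx : x ∈ S) (ha : a ∈ S) : impSISingle σ F' (f x) (f a) = impSISingle σ F x a := by
  unfold impSISingle
  congr 1
  · rw [← (Equiv.sigmaCongrRight fun n : {n : ℕ // Even n ∧ 0 < n} =>
      Equiv.ofBijective _ (h.mapPath_bijective hx ha n)).tsum_eq]
    exact tsum_congr fun p => hσ.pathWeight_mapPath h ha p.2
  · rw [← (Equiv.sigmaCongrRight fun n : {n : ℕ // Odd n} =>
      Equiv.ofBijective _ (h.mapPath_bijective hx ha n)).tsum_eq]
    exact tsum_congr fun p => hσ.pathWeight_mapPath h ha p.2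

end ShapleyCompatible

theorem impSISingle_eq_zero (σ : GradualSemantics U) {x a : U} (h : ¬ F.HasPath x a) :
    impSISingle σ F x a = 0 := by
  have : ∀ n, IsEmpty (F.Path x a n) := fun n => not_nonempty_iff.1 fun h' => h ⟨n, h'⟩
  have h1 : IsEmpty (EvenPath F x a) := ⟨fun p => (this _).false p.2⟩
  have h2 : IsEmpty (OddPath F x a) := ⟨fun p => (this _).false p.2⟩
  rw [impSISingle, tsum_empty, tsum_empty, sub_zero]

/-- From outside a closed set no path enters it, so the other members of `X` contribute nothing. -/
theorem impSI_eq_inter (σ : GradualSemantics U) (h : ∀ c ∈ S, F.attackers c ⊆ S) {X : Finset U}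
    {a : U} (ha : a ∈ S) : impSI σ F X a = impSI σ F (X ∩ S) a := by
  refine (Finset.sum_subset Finset.inter_subset_left fun x hx hxS => ?_).symm
  refine impSISingle_eq_zero σ (AF.not_hasPath_of_closed h ha fun h' => hxS ?_)
  exact Finset.mem_inter.2 ⟨hx, h'⟩

theorem ShapleyCompatible.impSI_eq {σ : GradualSemantics U} (hσ : ShapleyCompatible σ F F' S f)
    (h : F.LocalIso F' S f) {X X' : Finset U} (hX : ∀ c ∈ S, f c ∈ X' ↔ c ∈ X) {a : U}
    (ha : a ∈ S) : impSI σ F' X' (f a) = impSI σ F X a := by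
  rw [impSI_eq_inter σ h.closed ha,
    impSI_eq_inter σ h.image_closed (Finset.mem_image_of_mem f ha)]
  have : X' ∩ S.image f = (X ∩ S).image f := by
    ext c
    simp only [Finset.mem_inter, Finset.mem_image]
    constructor
    · rintro ⟨h1, c, hc, rfl⟩
      exact ⟨c, ⟨(hX c hc).1 h1, hc⟩, rfl⟩
    · rintro ⟨c, ⟨h1, hc⟩, rfl⟩
      exact ⟨(hX c hc).2 h1, c, hc, rfl⟩
  rw [this, impSI, impSI, Finset.sum_image (h.injOn.mono (by simp))]
  exact Finset.sum_congr rfl fun x hx => hσ.impSISingle_eq h (Finset.mem_inter.1 hx).2 ha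

theorem impactAnonymity_impSI {σ : GradualSemantics U} (hd : LocalDegreeUpToMax σ.degree) :
    ImpactAnonymity (impSI σ) := by
  intro F F' f hf X hX a ha
  have h := AF.LocalIso.ofIsIso hf
  have hi : F.args.image f = F'.args := by
    rw [← Finset.coe_inj, Finset.coe_image, hf.1.image_eq]
  refine ((hd.shapleyCompatible h (by simp [hi]) (by simp)).impSI_eq h (fun c hc => ?_) ha).symm
  simp only [Finset.mem_image]
  exact ⟨fun ⟨x, hx, hxc⟩ => h.injOn (hX hx) hc hxc ▸ hx, fun hx => ⟨c, hx, rfl⟩⟩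

theorem impactIndependence_impSI {σ : GradualSemantics U} (hd : LocalDegree σ.degree) :
    ImpactIndependence (impSI σ) := fun _ _ hF _ _ _ ha =>
  have h := AF.LocalIso.union hF
  ((hd.shapleyCompatible h).impSI_eq h (fun _ _ => Iff.rfl) ha).symm

theorem balancedImpact_impSI (σ : GradualSemantics U) : BalancedImpact (impSI σ) := by
  intro F X _ x' hx' a _
  rw [impSI, impSI, impSI, Finset.sum_union, Finset.sum_singleton]
  exact Finset.disjoint_singleton_right.2 (Finset.mem_sdiff.1 hx').2

theorem voidImpact_impSI (σ : GradualSemantics U) : VoidImpact (impSI σ) := fun _ _ _ =>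
  Finset.sum_empty

theorem impactDirectionality_impSI {σ : GradualSemantics U} (hd : LocalDegree σ.degree) :
    ImpactDirectionality (impSI σ) := fun F _ _ hb hx a ha hp _ _ =>
  have h := AF.LocalIso.addAttack hb hx ha hp
  ((hd.shapleyCompatible h).impSI_eq h (fun _ _ => Iff.rfl) (F.self_mem_str a)).symm

theorem impactMinimisation_impSI (σ : GradualSemantics U) : ImpactMinimisation (impSI σ) := by
  intro F X _ a _ x' hx' hp
  rw [impSI, impSI, Finset.sdiff_singleton_eq_erase, ← Finset.add_sum_erase X _ hx',
    impSISingle_eq_zero σ hp, zero_add]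

theorem zeroImpact_impSI (σ : GradualSemantics U) : ZeroImpact (impSI σ) := by
  intro F a _ x _ hp
  rw [impSI, Finset.sum_singleton, impSISingle_eq_zero σ hp]

theorem impactSymmetry_impSI {σ : GradualSemantics U} (hd : LocalDegreeUpToMax σ.degree) :
    ImpactSymmetry (impSI σ) := by
  rintro F a ha b hb f hf rfl _ X _
  have hsub := Finset.union_subset (AF.str_subset ha) (AF.str_subset hb)
  have h := AF.LocalIso.ofRestrict hsub (AF.str_union_closed ha hb) hf
  -- The automorphism permutes `S`, so the complements of `S` and of its image coincide, as the
  -- comparison of maximum in-degrees requires.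
  have hi : (F.str a ∪ F.str (f a)).image f = F.str a ∪ F.str (f a) := by
    have h1 := hf.1.image_eq
    have h2 : (F.restrict (F.str a ∪ F.str (f a))).args = F.str a ∪ F.str (f a) :=
      Finset.inter_eq_right.2 hsub
    rwa [h2, ← Finset.coe_image, Finset.coe_inj] at h1
  exact ((hd.shapleyCompatible h (by rw [hi]) fun _ _ => rfl).impSI_eq h
    (fun c hc => mem_image_inter_iff h.injOn hc)
    (Finset.mem_union_left _ (F.self_mem_str a))).symm

end Transfer

open scoped Nat in
/-- Efficiency of the Shapley value: the shares of the players add up to the value of the grand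
coalition. -/
theorem sum_shapleyValue {ι : Type*} [DecidableEq ι] (E : Finset ι) (v : Finset ι → ℝ) :
    ∑ e ∈ E, ∑ Z ∈ (E.erase e).powerset,
      ((Z.card ! * (E.card - Z.card - 1)! : ℕ) : ℝ) / (E.card ! : ℕ) * (v (insert e Z) - v Z) =
      v E - v ∅ := by
  set n := E.card with hn
  set c : ℕ → ℝ := fun k => ((k ! * (n - k - 1)! : ℕ) : ℝ) / (n ! : ℕ) with hc
  have hn0 : ((n ! : ℕ) : ℝ) ≠ 0 := by exact_mod_cast n.factorial_ne_zero
  -- A coalition `W` arises as `insert e Z` once for each `e ∈ W`.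
  have e1 : ∑ e ∈ E, ∑ Z ∈ (E.erase e).powerset, c Z.card * v (insert e Z) =
      ∑ W ∈ E.powerset, (W.card : ℝ) * c (W.card - 1) * v W := by
    have : ∀ e ∈ E, ∑ Z ∈ (E.erase e).powerset, c Z.card * v (insert e Z) =
        ∑ W ∈ E.powerset.filter (e ∈ ·), c (W.card - 1) * v W := fun e he => by
      refine Finset.sum_bij' (fun Z _ => insert e Z) (fun W _ => W.erase e) ?_ ?_ ?_ ?_ ?_
      · intro Z hZ
        simp only [Finset.mem_powerset, Finset.mem_filter] at hZ ⊢
        exact ⟨Finset.insert_subset he (hZ.trans (Finset.erase_subset _ _)),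
          Finset.mem_insert_self _ _⟩
      · intro W hW
        simp only [Finset.mem_powerset, Finset.mem_filter] at hW ⊢
        exact Finset.erase_subset_erase _ hW.1
      · intro Z hZ
        exact Finset.erase_insert fun h => Finset.notMem_erase e E (Finset.mem_powerset.1 hZ h)
      · intro W hW
        exact Finset.insert_erase (Finset.mem_filter.1 hW).2
      · intro Z hZ
        rw [Finset.card_insert_of_notMem
          fun h => Finset.notMem_erase e E (Finset.mem_powerset.1 hZ h), Nat.add_sub_cancel]
    rw [Finset.sum_congr rfl this, Finset.sum_comm' (t' := E.powerset) (s' := id)]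
    · refine Finset.sum_congr rfl fun W _ => ?_
      rw [id, Finset.sum_const, nsmul_eq_mul, mul_assoc]
    · intro e W
      simp only [Finset.mem_filter, Finset.mem_powerset, id]
      exact ⟨fun h => ⟨h.2.2, h.2.1⟩, fun h => ⟨h.2 h.1, h.2, h.1⟩⟩
  -- A coalition `W` arises as `Z` once for each `e ∈ E \ W`.
  have e2 : ∑ e ∈ E, ∑ Z ∈ (E.erase e).powerset, c Z.card * v Z =
      ∑ W ∈ E.powerset, ((n - W.card : ℕ) : ℝ) * c W.card * v W := by
    rw [Finset.sum_comm' (t' := E.powerset) (s' := fun W => E \ W)]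
    · refine Finset.sum_congr rfl fun W hW => ?_
      rw [Finset.sum_const, nsmul_eq_mul, mul_assoc,
        Finset.card_sdiff_of_subset (Finset.mem_powerset.1 hW)]
    · intro e W
      simp only [Finset.mem_powerset, Finset.mem_sdiff, Finset.subset_erase]
      tauto
  -- Both coefficients equal `|W|! (n - |W|)! / n!`, except that the first vanishes at `W = ∅` and
  -- the second at `W = E`. Only these two coalitions survive. The truncated `W.card - 1` at `W = ∅`
  -- is harmless because of the factor `W.card`.
  have e3 : ∀ W ∈ E.powerset, (W.card : ℝ) * c (W.card - 1) * v W -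
      ((n - W.card : ℕ) : ℝ) * c W.card * v W =
      (if W = E then v W else 0) - (if W = ∅ then v W else 0) := fun W hW => by
    have hWE := Finset.mem_powerset.1 hW
    have hle : W.card ≤ n := Finset.card_le_card hWE
    have hE : W = E ↔ W.card = n := ⟨fun h => by rw [h], fun h =>
      Finset.eq_of_subset_of_card_le hWE h.ge⟩
    have a1 : (W.card : ℝ) * c (W.card - 1) =
        if W = ∅ then 0 else ((W.card ! * (n - W.card)! : ℕ) : ℝ) / (n ! : ℕ) := by
      split_ifs with h
      · simp [h]
      · obtain ⟨k, hk⟩ := Nat.exists_eq_succ_of_ne_zero (Finset.card_ne_zero.2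
          (Finset.nonempty_iff_ne_empty.2 h))
        simp only [hc, hk, Nat.succ_sub_one, Nat.factorial_succ, Nat.succ_eq_add_one, Nat.sub_sub]
        push_cast
        ring
    have a2 : ((n - W.card : ℕ) : ℝ) * c W.card =
        if W = E then 0 else ((W.card ! * (n - W.card)! : ℕ) : ℝ) / (n ! : ℕ) := by
      split_ifs with h
      · simp [hE.1 h]
      · have h3 : n - W.card ≠ 0 := by
          have : W.card ≠ n := fun h' => h (hE.2 h')
          omega
        rw [← Nat.mul_factorial_pred h3]
        simp only [hc]
        push_cast
        ring
    rw [a1, a2]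
    rcases eq_or_ne W ∅ with rfl | h1
    · by_cases h2 : ∅ = E
      · simp only [if_pos h2, if_true]
        ring
      · simp only [if_neg h2, if_true, Finset.card_empty, Nat.factorial_zero, one_mul,
          Nat.sub_zero, div_self hn0]
        ring
    · by_cases h2 : W = E
      · rw [if_neg h1, if_neg h1, if_pos h2, if_pos h2, hE.1 h2]
        simp [hn0]
      · simp [h1, h2]
  calc _ = ∑ e ∈ E, ∑ Z ∈ (E.erase e).powerset, c Z.card * v (insert e Z) -
        ∑ e ∈ E, ∑ Z ∈ (E.erase e).powerset, c Z.card * v Z := by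
        simp only [← Finset.sum_sub_distrib, mul_sub, hc]
    _ = _ := by
        rw [e1, e2, ← Finset.sum_sub_distrib, Finset.sum_congr rfl e3, Finset.sum_sub_distrib,
          Finset.sum_ite_eq', Finset.sum_ite_eq']
        simp

/-! ### Path sums by length, convergence, and Impact Existence -/

section PathSums

variable {U : Type*} [DecidableEq U] {F : AF U} {σ : GradualSemantics U}

namespace AF.Path

omit [DecidableEq U] in
theorem cons_bijective (F : AF U) (x a : U) (n : ℕ) :
    Function.Bijective fun q : Σ c : {c // (x, c) ∈ F.attacks}, F.Path c a n =>
      (q.2.cons q.1.2 : F.Path x a (n + 1)) := by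
  constructor
  · rintro ⟨⟨c, hc⟩, p⟩ ⟨⟨c', hc'⟩, p'⟩ h
    have h1 : p.1 = p'.1 := (Fin.cons_injective2 (α := fun _ => U) (congrArg Subtype.val h)).2
    obtain rfl : c = c' := by
      have := congrFun h1 0
      rwa [p.2.1, p'.2.1] at this
    obtain rfl : p = p' := Subtype.ext h1
    rfl
  · intro q
    refine ⟨⟨⟨q.1 1, ?_⟩, ⟨Fin.tail q.1, rfl, q.2.2.1, fun i => ?_⟩⟩, Subtype.ext ?_⟩
    · have := q.2.2.2 0
      rwa [Fin.castSucc_zero, q.2.1] at this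
    · have := q.2.2.2 i.succ
      rwa [← Fin.succ_castSucc] at this
    · have h := Fin.cons_self_tail q.1
      rw [q.2.1] at h
      exact h

/-- This turns the sum over all paths of a fixed length into a finite sum, so that only the sum over
lengths raises a question of convergence. -/
instance finite (F : AF U) (x a : U) (n : ℕ) : Finite (F.Path x a n) := by
  induction n generalizing x with
  | zero =>
    have : Subsingleton (F.Path x a 0) := ⟨fun p q => Subtype.ext <| funext fun i => by
      rw [Fin.subsingleton_one.elim i 0, p.2.1, q.2.1]⟩
    infer_instance
  | succ n ih =>
    have : Finite {c // (x, c) ∈ F.attacks} :=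
      Finite.of_injective (fun c => (⟨c.1, F.right_mem _ c.2⟩ : {c // c ∈ F.args}))
        fun c c' h => Subtype.ext (congrArg (fun d : {c // c ∈ F.args} => (d : U)) h)
    exact Finite.of_surjective _ (cons_bijective F x a n).2

end AF.Path

theorem pathWeight_cons {x y a : U} {n : ℕ} (h : (x, y) ∈ F.attacks) (p : F.Path y a n) :
    pathWeight σ F (p.cons h) = shapley σ F x y * pathWeight σ F p := by
  rw [pathWeight, Fin.prod_univ_succ, pathWeight]
  congr 1
  exact congrArg (shapley σ F x) p.2.1

/-- The sum of the weights of all paths of length `n` from `x` to `a`. -/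
noncomputable def pathSum (σ : GradualSemantics U) (F : AF U) (a : U) (n : ℕ) (x : U) : ℝ :=
  ∑' p : F.Path x a n, pathWeight σ F p

theorem pathSum_zero (σ : GradualSemantics U) (F : AF U) (a x : U) :
    pathSum σ F a 0 x = if x = a then 1 else 0 := by
  split_ifs with h
  · subst h
    have : Unique (F.Path x x 0) := ⟨⟨⟨fun _ => x, rfl, rfl, fun i => i.elim0⟩⟩,
      fun p => Subtype.ext <| funext fun i =>
        (congrArg p.1 (Fin.subsingleton_one.elim i 0)).trans p.2.1⟩
    rw [pathSum, tsum_fintype, Fintype.sum_unique]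
    exact Fin.prod_univ_zero _
  · have : IsEmpty (F.Path x a 0) := ⟨fun p => h (p.2.1.symm.trans p.2.2.1)⟩
    rw [pathSum, tsum_empty]

theorem pathSum_succ (σ : GradualSemantics U) (F : AF U) (a : U) (n : ℕ) (x : U) :
    pathSum σ F a (n + 1) x =
      ∑ c ∈ F.args.filter fun c => (x, c) ∈ F.attacks, shapley σ F x c * pathSum σ F a n c := by
  have : Finite {c // (x, c) ∈ F.attacks} := Finite.of_equiv _ (Equiv.subtypeEquivRight fun c => by
      simp only [Finset.mem_filter, and_iff_right_iff_imp]
      exact F.right_mem _ : {c // c ∈ F.args.filter fun c => (x, c) ∈ F.attacks} ≃ _)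
  have := Fintype.ofFinite {c // (x, c) ∈ F.attacks}
  have := fun c => Fintype.ofFinite (F.Path c a n)
  have := Fintype.ofFinite (F.Path x a (n + 1))
  simp only [pathSum, tsum_fintype]
  rw [← (AF.Path.cons_bijective F x a n).sum_comp, Fintype.sum_sigma]
  simp only [pathWeight_cons, ← Finset.mul_sum]
  refine (Finset.sum_subtype _ (fun c => ?_) fun c =>
    shapley σ F x c * ∑ p : F.Path c a n, pathWeight σ F p).symm
  simp only [Finset.mem_filter, and_iff_right_iff_imp]
  exact F.right_mem _

/-- What is needed of the degrees of `F` without some of the attacks on an argument for the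
Shapley measures to be nonnegative, with sum less than `1` for each attacked argument. -/
structure ShapleyRegular (σ : GradualSemantics U) (F : AF U) : Prop where
  pos : ∀ a ∈ F.args, 0 < σ.degree F a
  mono : ∀ a ∈ F.args, ∀ Z ⊆ F.attacksOn a, ∀ e ∈ F.attacksOn a,
    σ.degree (F.deleteAttacks Z) a ≤ σ.degree (F.deleteAttacks (insert e Z)) a
  top : ∀ a ∈ F.args, σ.degree (F.deleteAttacks (F.attacksOn a)) a = 1

namespace ShapleyRegular

variable (h : ShapleyRegular σ F)
include h

theorem shapley_nonneg {a b : U} (hb : (b, a) ∈ F.attacks) : 0 ≤ shapley σ F b a :=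
  Finset.sum_nonneg fun Z hZ => mul_nonneg (by positivity) <| sub_nonneg.2 <|
    h.mono a (F.right_mem _ hb) Z ((Finset.mem_powerset.1 hZ).trans (Finset.erase_subset _ _)) _
      (AF.mem_attacksOn.2 ⟨hb, rfl⟩)

/-- Efficiency of the Shapley value for the game in which a coalition of attacks is worth the degree
of `a` after its deletion: the grand coalition is worth `1`, the empty one `σ.degree F a`. -/
theorem sum_shapley {a : U} (ha : a ∈ F.args) :
    ∑ b ∈ F.attackers a, shapley σ F b a = 1 - σ.degree F a := by
  have key := sum_shapleyValue (F.attacksOn a) fun Z => σ.degree (F.deleteAttacks Z) a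
  rw [h.top a ha, AF.deleteAttacks_empty] at key
  rw [← key]
  conv_rhs => rw [AF.attacksOn_eq_image]
  rw [Finset.sum_image fun b _ c _ h => (Prod.mk.inj h).1]
  refine Finset.sum_congr rfl fun b _ => ?_
  rw [← AF.attacksOn_eq_image, shapley, AF.card_attacksOn]

theorem pathWeight_nonneg {x a : U} {n : ℕ} (p : F.Path x a n) : 0 ≤ pathWeight σ F p :=
  Finset.prod_nonneg fun i _ => h.shapley_nonneg (p.2.2.2 i)

theorem pathSum_nonneg (a : U) (n : ℕ) (x : U) : 0 ≤ pathSum σ F a n x :=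
  tsum_nonneg fun p => h.pathWeight_nonneg p

/-- Split off the first attack. For a fixed second vertex `c`, summing over the starting points
gives the factor `1 - σ.degree F c ≤ ρ`; so each additional attack costs a factor `ρ`. -/
theorem sum_pathSum_le {ρ : ℝ} (h0 : 0 ≤ ρ) (hρ : ∀ c ∈ F.args, 1 - σ.degree F c ≤ ρ) {a : U}
    (ha : a ∈ F.args) (n : ℕ) : ∑ x ∈ F.args, pathSum σ F a n x ≤ ρ ^ n := by
  induction n with
  | zero => simp [pathSum_zero, ha]
  | succ n ih =>
    calc ∑ x ∈ F.args, pathSum σ F a (n + 1) x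
        = ∑ c ∈ F.args, ∑ x ∈ F.attackers c, shapley σ F x c * pathSum σ F a n c := by
          simp only [pathSum_succ]
          refine Finset.sum_comm' fun x c => ?_
          simp only [AF.attackers, Finset.mem_filter]
          tauto
      _ ≤ ∑ c ∈ F.args, ρ * pathSum σ F a n c := Finset.sum_le_sum fun c hc => by
          rw [← Finset.sum_mul, h.sum_shapley hc]
          exact mul_le_mul_of_nonneg_right (hρ c hc) (h.pathSum_nonneg a n c)
      _ ≤ ρ * ρ ^ n := by
          rw [← Finset.mul_sum]
          exact mul_le_mul_of_nonneg_left ih h0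
      _ = ρ ^ (n + 1) := by ring

theorem summable_pathSum {a : U} (ha : a ∈ F.args) {x : U} (hx : x ∈ F.args) :
    Summable fun n => pathSum σ F a n x := by
  -- The ratio is the largest `1 - σ.degree F c`; it is below `1` since the finitely many degrees
  -- are positive.
  obtain ⟨c, hc, hmax⟩ := F.args.exists_max_image (fun c => 1 - σ.degree F c) ⟨a, ha⟩
  have h0 : 0 ≤ 1 - σ.degree F c := sub_nonneg.2 (σ.degree_mem F c hc).2
  refine Summable.of_nonneg_of_le (fun n => h.pathSum_nonneg a n x) (fun n => ?_)
    (summable_geometric_of_lt_one h0 (by linarith [h.pos c hc]))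
  exact (Finset.single_le_sum (fun y _ => h.pathSum_nonneg a n y) hx).trans
    (h.sum_pathSum_le h0 hmax ha n)

/-- With nonnegative weights and finitely many paths of each length, summability over paths reduces
to summability over lengths. The predicate `P` covers both parities. -/
theorem summable_sigma {a : U} (ha : a ∈ F.args) {x : U} (hx : x ∈ F.args) (P : ℕ → Prop) :
    Summable fun p : Σ n : {n : ℕ // P n}, F.Path x a n => pathWeight σ F p.2 := by
  have h0 : ∀ p : Σ n : {n : ℕ // P n}, F.Path x a n, 0 ≤ pathWeight σ F p.2 := fun p =>
    h.pathWeight_nonneg p.2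
  exact (summable_sigma_of_nonneg h0).2 ⟨fun n => Summable.of_finite,
    (h.summable_pathSum ha hx).subtype {n | P n}⟩

theorem pathSummable : PathSummable σ F := fun _ hx _ ha =>
  ⟨h.summable_sigma ha hx fun n => Even n ∧ 0 < n, h.summable_sigma ha hx Odd⟩

theorem tsum_evenPath {a : U} (ha : a ∈ F.args) {x : U} (hx : x ∈ F.args) :
    ∑' p : EvenPath F x a, pathWeight σ F p.2 = ∑' n, pathSum σ F a (2 * n + 2) x := by
  rw [(h.summable_sigma ha hx fun n => Even n ∧ 0 < n).tsum_sigma]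
  let e : ℕ ≃ {n : ℕ // Even n ∧ 0 < n} :=
    { toFun n := ⟨2 * n + 2, ⟨n + 1, by ring⟩, by omega⟩
      invFun m := m.1 / 2 - 1
      left_inv n := by simp
      right_inv m := by
        obtain ⟨m, ⟨k, rfl⟩, hm⟩ := m
        refine Subtype.ext ?_
        dsimp only
        omega }
  exact (e.tsum_eq fun m => pathSum σ F a m.1 x).symm

theorem tsum_oddPath {a : U} (ha : a ∈ F.args) {x : U} (hx : x ∈ F.args) :
    ∑' p : OddPath F x a, pathWeight σ F p.2 = ∑' n, pathSum σ F a (2 * n + 1) x := by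
  rw [(h.summable_sigma ha hx Odd).tsum_sigma]
  let e : ℕ ≃ {n : ℕ // Odd n} :=
    { toFun n := ⟨2 * n + 1, n, rfl⟩
      invFun m := m.1 / 2
      left_inv n := by simp; omega
      right_inv m := by
        obtain ⟨m, k, rfl⟩ := m
        refine Subtype.ext ?_
        dsimp only
        omega }
  exact (e.tsum_eq fun m => pathSum σ F a m.1 x).symm

/-- The impact of `x` by the first attack of a path. -/
theorem impSISingle_recursion {a : U} (ha : a ∈ F.args) {x : U} (hx : x ∈ F.args) :
    impSISingle σ F x a = -∑ c ∈ F.args.filter fun c => (x, c) ∈ F.attacks,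
      shapley σ F x c * ((if c = a then 1 else 0) + impSISingle σ F c a) := by
  have hs : ∀ c ∈ F.args, ∀ k, Summable fun n => pathSum σ F a (2 * n + k) c := fun c hc k =>
    (h.summable_pathSum ha hc).comp_injective fun m n hmn => by simpa using hmn
  have hs0 : ∀ c ∈ F.args, Summable fun n => pathSum σ F a (2 * n) c := fun c hc => hs c hc 0
  have hmem : ∀ c ∈ F.args.filter fun c => (x, c) ∈ F.attacks, c ∈ F.args := fun c hc =>
    (Finset.mem_filter.1 hc).1
  have e1 : ∑' n, pathSum σ F a (2 * n + 2) x = ∑ c ∈ F.args.filter fun c => (x, c) ∈ F.attacks,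
      shapley σ F x c * ∑' n, pathSum σ F a (2 * n + 1) c := by
    simp only [pathSum_succ σ F a (_ + 1) x, show ∀ n, 2 * n + 2 = 2 * n + 1 + 1 from fun _ => rfl]
    rw [Summable.tsum_finsetSum fun c hc => (hs c (hmem c hc) 1).mul_left _]
    exact Finset.sum_congr rfl fun c _ => tsum_mul_left
  have e2 : ∑' n, pathSum σ F a (2 * n + 1) x = ∑ c ∈ F.args.filter fun c => (x, c) ∈ F.attacks,
      shapley σ F x c * ((if c = a then 1 else 0) + ∑' n, pathSum σ F a (2 * n + 2) c) := by
    simp only [pathSum_succ σ F a _ x]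
    rw [Summable.tsum_finsetSum fun c hc => (hs0 c (hmem c hc)).mul_left _]
    refine Finset.sum_congr rfl fun c hc => ?_
    -- What follows the first attack of an odd path has even length, possibly `0`. Paths of length
    -- `0` are not counted in the impact of `c` on `a`, and account for the term `if c = a then 1
    -- else 0`.
    rw [tsum_mul_left, (hs0 c (hmem c hc)).tsum_eq_zero_add]
    simp only [mul_zero, pathSum_zero, mul_add, mul_one]
  rw [impSISingle, h.tsum_evenPath ha hx, h.tsum_oddPath ha hx, e1, e2, ← Finset.sum_sub_distrib,
    ← Finset.sum_neg_distrib]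
  refine Finset.sum_congr rfl fun c hc => ?_
  rw [impSISingle, h.tsum_evenPath ha (hmem c hc), h.tsum_oddPath ha (hmem c hc)]
  ring

end ShapleyRegular

/-- If all single impacts on `a` vanish, the recursion at an attacker `b` of `a` leaves only the
Shapley measure of `(b, a)`, which is therefore `0`. By efficiency the degree of `a` is then `1`. -/
theorem impactExistenceOn_impSI {P : AF U → Prop} (h : ∀ F, P F → ShapleyRegular σ F) :
    ImpactExistenceOn P σ (impSI σ) := by
  intro F hF a ha hne
  have hr := h F hF
  by_contra! hz
  have hz : ∀ c ∈ F.args, impSISingle σ F c a = 0 := fun c hc => by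
    have := hz {c} (by simpa using hc)
    rwa [impSI, Finset.sum_singleton] at this
  refine hne (sub_eq_zero.1 ?_).symm
  rw [← hr.sum_shapley ha]
  refine Finset.sum_eq_zero fun b hb => ?_
  have hb' := AF.mem_attackers.1 hb
  have hbF := F.left_mem _ hb'
  have key := hr.impSISingle_recursion ha hbF
  rw [hz b hbF, Finset.sum_eq_single_of_mem a (Finset.mem_filter.2 ⟨ha, hb'⟩) fun c hc hca => by
    rw [if_neg hca, hz c (Finset.mem_filter.1 hc).1, add_zero, mul_zero], if_pos rfl, hz a ha] at key
  linarith

end PathSums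

/-! ### Fixed-point semantics as aggregations -/

section Aggregators

/-- If two frameworks differ at `a` only, where the second one aggregates at most as much, then
the degree of `a` is at least as large in the second one. -/
theorem le_of_scaling {U : Type*} {A : Finset U} {G G' : (U → ℝ) → U → ℝ}
    (hm : ∀ v w, 0 ≤ v → v ≤ w → G v ≤ G w)
    (hs : ∀ v, 0 ≤ v → ∀ t : ℝ, 0 < t → t ≤ 1 → t • G v ≤ G (t • v))
    {v v' : U → ℝ} (p : ∀ c ∈ A, 0 < v c) (p' : ∀ c ∈ A, 0 < v' c)
    (z : ∀ c ∉ A, v c = 0 ∧ v' c = 0)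
    (e : ∀ c ∈ A, v c * (1 + G v c) = 1) (e' : ∀ c ∈ A, v' c * (1 + G' v' c) = 1) {a : U}
    (ha : a ∈ A) (hle : ∀ c ∈ A, G' v' c ≤ G v' c) (hge : ∀ c ∈ A, c ≠ a → G v' c ≤ G' v' c) :
    v a ≤ v' a := by
  by_contra! hlt
  have hv : 0 ≤ v := fun c => by
    by_cases hc : c ∈ A
    · exact (p c hc).le
    · exact (z c hc).1.ge
  have hv' : 0 ≤ v' := fun c => by
    by_cases hc : c ∈ A
    · exact (p' c hc).le
    · exact (z c hc).2.ge
  -- At `c` the two solutions differ most in ratio, and `t` is the ratio of the smaller to the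
  -- larger one. Each solution dominates `t` times the other everywhere.
  obtain ⟨c, hc, hmin⟩ := A.exists_min_image (fun c => min (v c / v' c) (v' c / v c)) ⟨a, ha⟩
  set t := min (v c / v' c) (v' c / v c) with ht
  have t0 : 0 < t := lt_min (div_pos (p c hc) (p' c hc)) (div_pos (p' c hc) (p c hc))
  have t1 : t < 1 := ((hmin a ha).trans (min_le_right _ _)).trans_lt ((div_lt_one (p a ha)).2 hlt)
  have r1 : t • v' ≤ v := fun b => by
    by_cases hb : b ∈ A
    · have := (hmin b hb).trans (min_le_left _ _)
      rw [le_div_iff₀ (p' b hb)] at this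
      simpa using this
    · simp [z b hb]
  have r2 : t • v ≤ v' := fun b => by
    by_cases hb : b ∈ A
    · have := (hmin b hb).trans (min_le_right _ _)
      rw [le_div_iff₀ (p b hb)] at this
      simpa using this
    · simp [z b hb]
  have g1 : t * G v c ≤ G v' c := (hs v hv t t0 t1.le c).trans (hm _ _ (smul_nonneg t0.le hv) r2 c)
  have g2 : t * G v' c ≤ G v c :=
    (hs v' hv' t t0 t1.le c).trans (hm _ _ (smul_nonneg t0.le hv') r1 c)
  have hec := e c hc
  have hec' := e' c hc
  -- If `v c` is the smaller value, then `c ≠ a` and the systems agree at `c`; if `v' c` is the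
  -- smaller one, `G' v' c ≤ G v' c` suffices. In both cases the two equations at `c` force `t ≥ 1`.
  rcases min_choice (v c / v' c) (v' c / v c) with h | h
  · have ht' : t * v' c = v c := by rw [ht, h, div_mul_cancel₀ _ (p' c hc).ne']
    have hca : c ≠ a := by
      rintro rfl
      nlinarith [p' c hc]
    have key : t * (1 + G v c) = 1 + G' v' c :=
      mul_left_cancel₀ (p' c hc).ne' (by
        linear_combination (1 + G v c) * ht' + hec - hec')
    linarith [hge c hc hca]
  · have ht' : t * v c = v' c := by rw [ht, h, div_mul_cancel₀ _ (p c hc).ne']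
    have key : t * (1 + G' v' c) = 1 + G v c :=
      mul_left_cancel₀ (p c hc).ne' (by
        linear_combination (1 + G' v' c) * ht' + hec' - hec)
    linarith [mul_le_mul_of_nonneg_left (hle c hc) t0.le]

variable {U : Type*} [DecidableEq U]

/-- An aggregation of the degrees of a set of attackers. -/
structure IsAggregator (H : Finset U → (U → ℝ) → ℝ) : Prop where
  nonneg : ∀ s v, 0 ≤ v → 0 ≤ H s v
  mono_right : ∀ s v w, 0 ≤ v → v ≤ w → H s v ≤ H s w
  mul_le : ∀ s v, 0 ≤ v → ∀ t : ℝ, 0 < t → t ≤ 1 → t * H s v ≤ H s (t • v)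
  mono_left : ∀ s s' v, s ⊆ s' → 0 ≤ v → v ≤ 1 → H s v ≤ H s' v
  image : ∀ (s : Finset U) (f : U → U) v w, Set.InjOn f s → (∀ b ∈ s, w (f b) = v b) →
    H (s.image f) w = H s v
  empty : ∀ v, H ∅ v = 0

/-- The degrees under `σ` solve the system given by the aggregation `H`. -/
def IsAggregatedBy (σ : GradualSemantics U) (H : Finset U → (U → ℝ) → ℝ) : Prop :=
  ∀ F, IsSolution F (fun w a => H (F.attackers a) w) (σ.degree F)

namespace IsAggregatedBy

variable {H : Finset U → (U → ℝ) → ℝ} {σ : GradualSemantics U}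

theorem degree_eq (hσ : IsAggregatedBy σ H) {F : AF U} {a : U} (ha : a ∈ F.args) :
    σ.degree F a = 1 / (1 + H (F.attackers a) (σ.degree F)) := ((hσ F).1 a ha).2

theorem degree_nonneg (hσ : IsAggregatedBy σ H) (F : AF U) : 0 ≤ σ.degree F := fun a => by
  by_cases ha : a ∈ F.args
  · exact ((hσ F).1 a ha).1.1
  · exact ((hσ F).2 a ha).ge

theorem degree_le_one (hσ : IsAggregatedBy σ H) (F : AF U) : σ.degree F ≤ 1 := fun a => by
  by_cases ha : a ∈ F.args
  · exact ((hσ F).1 a ha).1.2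
  · rw [(hσ F).2 a ha]
    exact zero_le_one

theorem degree_eq_one (hσ : IsAggregatedBy σ H) (hH : IsAggregator H) {F : AF U} {a : U}
    (ha : a ∈ F.args) (h : F.attackers a = ∅) : σ.degree F a = 1 := by
  rw [hσ.degree_eq ha, h, hH.empty, add_zero, div_one]

theorem degree_pos (hσ : IsAggregatedBy σ H) (hH : IsAggregator H) {F : AF U} {a : U}
    (ha : a ∈ F.args) : 0 < σ.degree F a := by
  rw [hσ.degree_eq ha]
  have := hH.nonneg (F.attackers a) _ (hσ.degree_nonneg F)
  positivity

/-- Both degree functions, read on `S` and cut off to `0` outside, solve the system of `F` on `S`,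
which closedness makes self-contained. The scaling argument `eq_of_scaling` identifies them. -/
theorem localDegree (hσ : IsAggregatedBy σ H) (hH : IsAggregator H) : LocalDegree σ.degree := by
  intro F F' S f h c hc
  let v : U → ℝ := fun a => if a ∈ S then σ.degree F a else 0
  let v' : U → ℝ := fun a => if a ∈ S then σ.degree F' (f a) else 0
  have hvS : ∀ a ∈ S, v a = σ.degree F a := fun a ha => if_pos ha
  have hvS' : ∀ a ∈ S, v' a = σ.degree F' (f a) := fun a ha => if_pos ha
  have hv : 0 ≤ v := fun a => by
    simp only [v]
    split_ifs
    exacts [hσ.degree_nonneg F a, le_rfl]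
  have hv' : 0 ≤ v' := fun a => by
    simp only [v']
    split_ifs
    exacts [hσ.degree_nonneg F' (f a), le_rfl]
  have key : v = v' := by
    refine eq_of_scaling (A := S) (G := fun w a => H (F.attackers a) w)
      (fun v hv a => hH.nonneg _ v hv) (fun v w hv hw a => hH.mono_right _ v w hv hw)
      (fun v hv t t0 t1 a => hH.mul_le _ v hv t t0 t1) hv hv' (Or.inl ⟨rfl, rfl⟩)
      (fun a ha => ⟨if_neg ha, if_neg ha⟩) (fun a ha => ?_) fun a ha => ?_
    · have := hH.image (F.attackers a) id v (σ.degree F) (Set.injOn_id _)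
        fun b hb => (hvS b (h.closed a ha hb)).symm
      rw [Finset.image_id] at this
      rw [hvS a ha, hσ.degree_eq (h.subset ha), this]
    · rw [hvS' a ha, hσ.degree_eq (h.mapsTo a ha), h.attackers_eq a ha,
        hH.image (F.attackers a) f v' _ (h.injOn.mono (h.closed a ha))
          fun b hb => (hvS' b (h.closed a ha hb)).symm]
  rw [← hvS c hc, ← hvS' c hc, key]

/-- Deleting one more attack on `a` changes the system at `a` only and lowers the aggregation there,
which is the situation of `le_of_scaling`. -/
theorem shapleyRegular (hσ : IsAggregatedBy σ H) (hH : IsAggregator H) (F : AF U) :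
    ShapleyRegular σ F where
  pos _ ha := hσ.degree_pos hH ha
  top a ha := hσ.degree_eq_one hH ha <| Finset.eq_empty_of_forall_notMem fun b hb => by
    have := AF.mem_attackers_deleteAttacks.1 hb
    exact this.2 (AF.mem_attacksOn.2 ⟨AF.mem_attackers.1 this.1, rfl⟩)
  mono a ha Z _ e he := by
    have e1 : ∀ F : AF U, ∀ c ∈ F.args,
        σ.degree F c * (1 + H (F.attackers c) (σ.degree F)) = 1 := fun F c hc => by
      have h0 := hH.nonneg (F.attackers c) _ (hσ.degree_nonneg F)
      conv_lhs => rw [hσ.degree_eq hc]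
      field_simp
    refine le_of_scaling (A := F.args) (G := fun w c => H ((F.deleteAttacks Z).attackers c) w)
      (G' := fun w c => H ((F.deleteAttacks (insert e Z)).attackers c) w)
      (v := σ.degree (F.deleteAttacks Z)) (v' := σ.degree (F.deleteAttacks (insert e Z)))
      (fun v w hv hw a => hH.mono_right _ v w hv hw)
      (fun v hv t t0 t1 a => hH.mul_le _ v hv t t0 t1)
      (fun c hc => hσ.degree_pos hH hc) (fun c hc => hσ.degree_pos hH hc)
      (fun c hc => ⟨(hσ (F.deleteAttacks Z)).2 c hc,
        (hσ (F.deleteAttacks (insert e Z))).2 c hc⟩)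
      (fun c hc => e1 (F.deleteAttacks Z) c hc)
      (fun c hc => e1 (F.deleteAttacks (insert e Z)) c hc) ha (fun c _ => ?_) fun c _ hca => ?_
    · refine hH.mono_left _ _ _ (fun b hb => ?_) (hσ.degree_nonneg _) (hσ.degree_le_one _)
      rw [AF.mem_attackers_deleteAttacks] at hb ⊢
      exact ⟨hb.1, fun h => hb.2 (Finset.mem_insert_of_mem h)⟩
    · refine hH.mono_left _ _ _ (fun b hb => ?_) (hσ.degree_nonneg _) (hσ.degree_le_one _)
      rw [AF.mem_attackers_deleteAttacks] at hb ⊢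
      refine ⟨hb.1, fun h => (Finset.mem_insert.1 h).elim (fun h' => hca ?_) hb.2⟩
      rw [← (AF.mem_attacksOn.1 he).2, ← h']

end IsAggregatedBy

theorem isAggregator_sum : IsAggregator fun (s : Finset U) w => ∑ b ∈ s, w b where
  nonneg s v hv := Finset.sum_nonneg fun b _ => hv b
  mono_right s v w _ h := Finset.sum_le_sum fun b _ => h b
  mul_le s v _ t _ _ := by simp [Finset.mul_sum]
  mono_left s s' v h hv _ := Finset.sum_le_sum_of_subset_of_nonneg h fun b _ _ => hv b
  image s f v w hf h := by
    rw [Finset.sum_image hf]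
    exact Finset.sum_congr rfl h
  empty v := Finset.sum_empty

theorem isAggregator_max : IsAggregator fun (s : Finset U) w => ⨆ b : {b // b ∈ s}, w b where
  nonneg s v hv := Real.iSup_nonneg fun b => hv b
  mono_right s v w _ h := ciSup_mono (Set.finite_range _).bddAbove fun b => h b
  mul_le s v _ t ht _ := by
    simp only [Pi.smul_apply, smul_eq_mul]
    rw [Real.mul_iSup_of_nonneg ht.le]
  mono_left s s' v h hv _ := by
    refine Real.iSup_le (fun b => ?_) (Real.iSup_nonneg fun b => hv b)
    exact le_ciSup (f := fun b : {b // b ∈ s'} => v b) (Set.finite_range _).bddAbove ⟨b, h b.2⟩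
  image s f v w _ h := by
    refine (Function.Surjective.iSup_congr
      (fun b : {b // b ∈ s} => (⟨f b, Finset.mem_image_of_mem f b.2⟩ : {b // b ∈ s.image f}))
      (fun c => ?_) fun b => h b b.2).symm
    obtain ⟨c, hc⟩ := c
    obtain ⟨b, hb, rfl⟩ := Finset.mem_image.1 hc
    exact ⟨⟨b, hb⟩, rfl⟩
  empty v := Real.iSup_of_isEmpty _

theorem isAggregator_card :
    IsAggregator fun (s : Finset U) w => (s.card : ℝ) + (∑ b ∈ s, w b) / s.card where
  nonneg s v hv := by
    have : 0 ≤ ∑ b ∈ s, v b := Finset.sum_nonneg fun b _ => hv b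
    positivity
  mono_right s v w _ h := by
    have : ∑ b ∈ s, v b ≤ ∑ b ∈ s, w b := Finset.sum_le_sum fun b _ => h b
    gcongr
  mul_le s v _ t _ ht := by
    simp only [Pi.smul_apply, smul_eq_mul, ← Finset.mul_sum, mul_add, mul_div_assoc]
    have : (0 : ℝ) ≤ s.card := by positivity
    nlinarith
  mono_left s s' v h hv hv1 := by
    rcases eq_or_ne s s' with rfl | hne
    · exact le_rfl
    -- A proper superset raises the count by at least `1`, while the mean, lying in `[0, 1]`, drops
    -- by at most `1`. This is why `mono_left` assumes `v ≤ 1`.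
    have h1 : (s.card : ℝ) + 1 ≤ s'.card := by
      exact_mod_cast Finset.card_lt_card (h.ssubset_of_ne hne)
    have h2 : (∑ b ∈ s, v b) / s.card ≤ 1 := by
      refine div_le_one_of_le₀ ?_ (Nat.cast_nonneg _)
      calc ∑ b ∈ s, v b ≤ ∑ b ∈ s, (1 : ℝ) := Finset.sum_le_sum fun b _ => hv1 b
        _ = s.card := by simp
    have h3 : 0 ≤ (∑ b ∈ s', v b) / s'.card :=
      div_nonneg (Finset.sum_nonneg fun b _ => hv b) (Nat.cast_nonneg _)
    linarith
  image s f v w hf h := by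
    rw [Finset.sum_image hf, Finset.card_image_of_injOn hf, Finset.sum_congr rfl h]
  empty v := by simp

theorem isAggregatedBy_hCategoriser :
    IsAggregatedBy (hCategoriser U) fun s w => ∑ b ∈ s, w b := fun F =>
  (existsUnique_sum F).choose_spec.1

theorem isAggregatedBy_maxBased :
    IsAggregatedBy (maxBased U) fun s w => ⨆ b : {b // b ∈ s}, w b := fun F =>
  (existsUnique_max F).choose_spec.1

theorem isAggregatedBy_cardBased :
    IsAggregatedBy (cardBased U) fun s w => (s.card : ℝ) + (∑ b ∈ s, w b) / s.card := fun F =>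
  (existsUnique_card F).choose_spec.1

end Aggregators

/-! ### Failure of Balanced Impact for deletion -/

section Chain

variable {U : Type*} [DecidableEq U] [Infinite U]

/-- Balanced Impact fails on `e → b → c → a` for `{c}` and `e`: the impact of `e` vanishes in the
presence of `c`. -/
theorem not_balancedImpact_of_deletionDiff {I : Impact U} {d : ℕ → AF U → U → ℝ} {g : ℕ → ℝ → ℝ}
    (hI : ∀ F, I F = deletionDiff (d F.maxInDegree) F)
    (h1 : ∀ N F, F.maxInDegree ≤ N → ∀ a ∈ F.args, F.attackers a = ∅ → d N F a = 1)
    (h2 : ∀ N F, F.maxInDegree ≤ N → ∀ a ∈ F.args, ∀ b, F.attackers a = {b} →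
      d N F a = g N (d N F b))
    (hg : ∀ N, N ≠ 0 → Function.Injective (g N) ∧ g N 1 ≠ 1) : ¬ BalancedImpact I := by
  obtain ⟨u, hu⟩ : ∃ u : ℕ → U, Function.Injective u :=
    ⟨_, (Infinite.natEmbedding U).injective⟩
  have hne : ∀ i j, u i = u j ↔ i = j := fun i j => hu.eq_iff
  let F : AF U :=
    { args := {u 0, u 1, u 2, u 3}
      attacks := {(u 3, u 2), (u 2, u 1), (u 1, u 0)}
      left_mem := by simp
      right_mem := by simp }
  have att : ∀ x y, x ∈ F.attackers y ↔
      x = u 3 ∧ y = u 2 ∨ x = u 2 ∧ y = u 1 ∨ x = u 1 ∧ y = u 0 := fun x y => by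
    simp [AF.mem_attackers, F]
  set N := F.maxInDegree with hN
  -- For `N = 0` the map `g N` of the counting semantics is constant, so injectivity is available
  -- only for `N ≠ 0`.
  have hN0 : N ≠ 0 := by
    have := F.card_attackers_le_maxInDegree (a := u 0) (by simp [F])
    have h3 : 0 < (F.attackers (u 0)).card := Finset.card_pos.2 ⟨u 1, by simp [att]⟩
    omega
  obtain ⟨ginj, g1⟩ := hg N hN0
  have hdel : ∀ X, (F.deleteAttacks (F.externalAttacks X)).maxInDegree ≤ N := fun X =>
    F.maxInDegree_deleteAttacks_le _
  have hdel' : ∀ y X, (F.deleteArgs y X).maxInDegree ≤ N := fun y X =>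
    F.maxInDegree_deleteArgs_le y X
  intro hB
  have key := hB F {u 1} (by simp [F]) (u 3) (by simp [F, hne]) (u 0) (by simp [F])
  -- This covers both `{c}` and `{c, e}`: the attack of `b` on `c` is external, so `c` becomes
  -- unattacked, and without `c` so is `a`. Balance would thus force the impact of `e` alone to be
  -- `0`.
  have hc : ∀ X, u 1 ∈ X → u 0 ∉ X → u 2 ∉ X → I F X (u 0) = g N 1 - 1 := fun X hX hX0 hX2 => by
    rw [hI, ← hN, deletionDiff, h2 N _ (hdel X) (u 0) (by simp [F, AF.deleteAttacks]) (u 1),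
      h1 N _ (hdel X) (u 1) (by simp [F, AF.deleteAttacks]),
      h1 N _ (hdel' _ X) (u 0) (by simp [F, AF.deleteArgs])]
    · ext x
      simp only [AF.mem_attackers_deleteArgs, att, hne, Finset.notMem_empty]
      aesop
    · ext x
      simp only [AF.mem_attackers_deleteExternal, att, hne, Finset.notMem_empty]
      aesop
    · ext x
      simp only [AF.mem_attackers_deleteExternal, att, hne, Finset.mem_singleton]
      aesop
  -- Nothing attacks `e`, so the impact compares the whole chain with the chain without `e`.
  have he : I F {u 3} (u 0) = g N (g N (g N 1)) - g N (g N 1) := by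
    rw [hI, ← hN, deletionDiff, h2 N _ (hdel _) (u 0) (by simp [F, AF.deleteAttacks]) (u 1),
      h2 N _ (hdel _) (u 1) (by simp [F, AF.deleteAttacks]) (u 2),
      h2 N _ (hdel _) (u 2) (by simp [F, AF.deleteAttacks]) (u 3),
      h1 N _ (hdel _) (u 3) (by simp [F, AF.deleteAttacks]),
      h2 N _ (hdel' _ _) (u 0) (by simp [F, AF.deleteArgs]) (u 1),
      h2 N _ (hdel' _ _) (u 1) (by simp [F, AF.deleteArgs, hne]) (u 2),
      h1 N _ (hdel' _ _) (u 2) (by simp [F, AF.deleteArgs, hne])]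
    all_goals
      ext x
      simp [AF.mem_attackers_deleteArgs, AF.mem_attackers_deleteExternal, att, hne]
    all_goals
      rintro rfl
      simp [hne]
  rw [hc _ (by simp) (by simp [hne]) (by simp [hne]), he,
    hc _ (by simp) (by simp [hne]) (by simp [hne])] at key
  -- Cancelling `g N` twice leaves `g N 1 = 1`.
  exact g1 (ginj (ginj (by linarith)))

/-- On a single attacker the three aggregations agree up to the constant `κ`, which is `1` for the
card-based one and `0` for the others. -/
theorem not_balancedImpact_impDV {σ : GradualSemantics U} {H : Finset U → (U → ℝ) → ℝ}
    (hσ : IsAggregatedBy σ H) (hH : IsAggregator H) {κ : ℝ} (hκ : 0 ≤ κ)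
    (hs : ∀ b v, H {b} v = κ + v b) : ¬ BalancedImpact (impDV σ) := by
  refine not_balancedImpact_of_deletionDiff (d := fun _ => σ.degree)
    (g := fun _ x => 1 / (1 + (κ + x))) (fun _ => rfl)
    (fun _ F _ a ha h => hσ.degree_eq_one hH ha h) (fun _ F _ a ha b h => ?_) fun _ _ => ⟨?_, ?_⟩
  · rw [hσ.degree_eq ha, h, hs]
  · intro x y hxy
    simpa using hxy
  · rw [Ne, div_eq_iff (by positivity)]
    intro h
    linarith

end Chain

/-! ### The counting semantics: linear system, locality, monotonicity -/

section CountingModel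

variable {U : Type*} [DecidableEq U]

theorem attackMatrix_mulVec_eq_sum (F : AF U) (v : U → ℝ) (a : {a // a ∈ F.args}) :
    (attackMatrix F).mulVec (fun b => v b) a = ∑ b ∈ F.attackers a, v b := by
  have : (attackMatrix F).mulVec (fun b => v b) a =
      ∑ b ∈ F.args, if (b, (a : U)) ∈ F.attacks then v b else 0 := by
    rw [← Finset.sum_coe_sort F.args]
    refine Finset.sum_congr rfl fun b _ => ?_
    simp [attackMatrix]
  rw [this, AF.attackers, Finset.sum_filter]

/-- The entries of `(M / N) ^ i * 1`, where `M` is the attack matrix. -/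
noncomputable def countingPower (N : ℝ) (F : AF U) : ℕ → U → ℝ
  | 0, _ => 1
  | i + 1, a => N⁻¹ * ∑ b ∈ F.attackers a, countingPower N F i b

theorem pow_mulVec_one (N : ℝ) (F : AF U) (i : ℕ) :
    ((N⁻¹ • attackMatrix F) ^ i).mulVec (fun _ => 1) =
      fun a : {a // a ∈ F.args} => countingPower N F i a := by
  induction i with
  | zero => ext; simp [countingPower]
  | succ i ih =>
    ext a
    rw [pow_succ', ← Matrix.mulVec_mulVec, ih, Matrix.smul_mulVec, Pi.smul_apply,
      attackMatrix_mulVec_eq_sum, smul_eq_mul, countingPower]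

theorem countingVector_eq (α N : ℝ) (F : AF U) (k : ℕ) (a : {a // a ∈ F.args}) :
    countingVector α N F k a =
      ∑ i ∈ Finset.range (k + 1), ((-1) ^ i * α ^ i) * countingPower N F i a := by
  simp [countingVector, pow_mulVec_one]

/-- With `N` fixed, each entry of `(M / N) ^ i * 1` is computed from the attackers' entries of the
previous power, so induction on `i` carries it along a local isomorphism. -/
theorem localDegree_countingDegree (α N : ℝ) :
    LocalDegree (countingDegree α N : AF U → U → ℝ) := by
  intro F F' S f h c hc
  have key : ∀ i, ∀ c ∈ S, countingPower N F' i (f c) = countingPower N F i c := fun i => by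
    induction i with
    | zero => exact fun c _ => rfl
    | succ i ih =>
      intro c hc
      rw [countingPower, countingPower, h.attackers_eq c hc,
        Finset.sum_image (h.injOn.mono (h.closed c hc))]
      rw [Finset.sum_congr rfl fun b hb => ih b (h.closed c hc hb)]
  rw [countingDegree, countingDegree, dif_pos (h.mapsTo c hc), dif_pos (h.subset hc)]
  congr 1
  funext k
  simp only [countingVector_eq, key _ c hc]

theorem localDegreeUpToMax_countingSemantics (α : Set.Ioo (0 : ℝ) 1) :
    LocalDegreeUpToMax (countingSemantics U α).degree := fun F F' S f h hN c hc => by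
  simp only [countingSemantics]
  rw [← hN]
  exact localDegree_countingDegree _ _ F F' S f h c hc

/-- The degrees of the counting model solve a linear system. -/
theorem countingDegree_eq {α N : ℝ} (hα : α ∈ Set.Ioo (0 : ℝ) 1) {F : AF U}
    (hN : (F.maxInDegree : ℝ) ≤ N) {a : U} (ha : a ∈ F.args) :
    countingDegree α N F a = 1 - α * (N⁻¹ * ∑ b ∈ F.attackers a, countingDegree α N F b) := by
  -- Pass to the limit in the recursion `v (k + 1) = 1 - α (M / N) v k`.
  have h1 := (tendsto_countingDegree hα F hN ha).comp (tendsto_add_atTop_nat 1)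
  have h2 : Tendsto (fun k => 1 - α * (N⁻¹ * ∑ b ∈ F.attackers a,
      ∑ i ∈ Finset.range (k + 1), ((-1) ^ i * α ^ i) * countingPower N F i b)) atTop
      (𝓝 (1 - α * (N⁻¹ * ∑ b ∈ F.attackers a, countingDegree α N F b))) := by
    refine tendsto_const_nhds.sub (Tendsto.const_mul _ (Tendsto.const_mul _
      (tendsto_finsetSum _ fun b hb => ?_)))
    have := tendsto_countingDegree hα F hN (F.attackers_subset a hb)
    simpa only [countingVector_eq] using this
  refine tendsto_nhds_unique h1 (h2.congr fun k => ?_)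
  rw [Function.comp, countingVector_eq, Finset.sum_range_succ', Finset.sum_comm]
  simp only [countingPower, pow_zero, mul_one, ← Finset.mul_sum]
  rw [sub_eq_neg_add, Finset.mul_sum, Finset.mul_sum, ← Finset.sum_neg_distrib]
  congr 1
  refine Finset.sum_congr rfl fun i _ => ?_
  ring

theorem countingDegree_eq_one {α N : ℝ} (hα : α ∈ Set.Ioo (0 : ℝ) 1) {F : AF U}
    (hN : (F.maxInDegree : ℝ) ≤ N) {a : U} (ha : a ∈ F.args) (h : F.attackers a = ∅) :
    countingDegree α N F a = 1 := by
  rw [countingDegree_eq hα hN ha, h, Finset.sum_empty, mul_zero, mul_zero, sub_zero]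

/-- The rows of `M / N` have sum at most `1`. The case `N = 0` is included, since then `N⁻¹ = 0`. -/
theorem inv_mul_sum_attackers_le {N : ℝ} {F : AF U} (hN : (F.maxInDegree : ℝ) ≤ N) {a : U}
    (ha : a ∈ F.args) {v : U → ℝ} {m : ℝ} (hm : 0 ≤ m) (hv : ∀ b ∈ F.attackers a, v b ≤ m) :
    N⁻¹ * ∑ b ∈ F.attackers a, v b ≤ m := by
  have hc : ((F.attackers a).card : ℝ) ≤ N :=
    le_trans (by exact_mod_cast F.card_attackers_le_maxInDegree ha) hN
  have hN0 : 0 ≤ N := (Nat.cast_nonneg _).trans hc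
  calc N⁻¹ * ∑ b ∈ F.attackers a, v b ≤ N⁻¹ * (N * m) := by
        refine mul_le_mul_of_nonneg_left ?_ (inv_nonneg.2 hN0)
        refine (Finset.sum_le_card_nsmul _ _ m hv).trans ?_
        rw [nsmul_eq_mul]
        exact mul_le_mul_of_nonneg_right hc hm
    _ = (N⁻¹ * N) * m := by ring
    _ ≤ m := mul_le_of_le_one_left hm inv_mul_le_one

theorem countingDegree_pos {α N : ℝ} (hα : α ∈ Set.Ioo (0 : ℝ) 1) {F : AF U}
    (hN : (F.maxInDegree : ℝ) ≤ N) {a : U} (ha : a ∈ F.args) : 0 < countingDegree α N F a := by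
  rw [countingDegree_eq hα hN ha]
  have := inv_mul_sum_attackers_le hN ha zero_le_one fun b hb =>
    (countingDegree_mem hα F hN (F.attackers_subset a hb)).2
  nlinarith [hα.1, hα.2]

/-- Fewer attacks on `a` yield a larger degree of `a` in the counting model. -/
theorem countingDegree_mono {α N : ℝ} (hα : α ∈ Set.Ioo (0 : ℝ) 1) {F F' : AF U}
    (hN : (F.maxInDegree : ℝ) ≤ N) (hN' : (F'.maxInDegree : ℝ) ≤ N) (hargs : F'.args = F.args)
    {a : U} (ha : a ∈ F.args) (hsub : F'.attackers a ⊆ F.attackers a)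
    (heq : ∀ c ∈ F.args, c ≠ a → F'.attackers c = F.attackers c) :
    countingDegree α N F a ≤ countingDegree α N F' a := by
  by_contra! hlt
  set v := countingDegree α N F
  set v' := countingDegree α N F'
  have hN0 : 0 ≤ N⁻¹ := inv_nonneg.2 ((Nat.cast_nonneg _).trans hN)
  -- At `c` the two degree functions differ most, by `m > 0`. The linear systems will give `m ≤ α *
  -- m`.
  obtain ⟨c, hc, hmax⟩ := F.args.exists_max_image (fun c => |v c - v' c|) ⟨a, ha⟩
  set m := |v c - v' c|
  have hm : 0 < m := (abs_pos.2 (sub_pos.2 hlt).ne').trans_le (hmax a ha)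
  have hle : ∀ x ∈ F.args, N⁻¹ * ∑ b ∈ F.attackers x, (v b - v' b) ≤ m := fun x hx =>
    inv_mul_sum_attackers_le hN hx hm.le fun b hb =>
      (le_abs_self _).trans (hmax b (F.attackers_subset x hb))
  have hge : ∀ x ∈ F.args, N⁻¹ * ∑ b ∈ F.attackers x, (v' b - v b) ≤ m := fun x hx =>
    inv_mul_sum_attackers_le hN hx hm.le fun b hb =>
      (le_abs_self _).trans ((abs_sub_comm _ _).trans_le (hmax b (F.attackers_subset x hb)))
  have e := countingDegree_eq hα hN hc
  have e' := countingDegree_eq hα hN' (hargs ▸ hc)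
  change v c = 1 - α * (N⁻¹ * ∑ b ∈ F.attackers c, v b) at e
  change v' c = 1 - α * (N⁻¹ * ∑ b ∈ F'.attackers c, v' b) at e'
  have h1 := hle c hc
  have h2 := hge c hc
  simp only [Finset.sum_sub_distrib, mul_sub] at h1 h2
  have hmα : α * m < m := mul_lt_of_lt_one_left hm hα.2
  -- At `a`, where `v a > v' a`, dropping attackers only decreases the sum of the `v'`, so the
  -- one-sided estimate still applies. Elsewhere the attackers agree, and both signs are estimated.
  by_cases hca : c = a
  · have h3 : N⁻¹ * ∑ b ∈ F'.attackers c, v' b ≤ N⁻¹ * ∑ b ∈ F.attackers c, v' b := by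
      refine mul_le_mul_of_nonneg_left ?_ hN0
      refine Finset.sum_le_sum_of_subset_of_nonneg (hca ▸ hsub) fun b hb _ => ?_
      exact (countingDegree_mem hα F' hN' (hargs ▸ F.attackers_subset c hb)).1
    have hmc : m = v c - v' c := abs_of_pos (by rw [hca]; exact sub_pos.2 hlt)
    nlinarith [hα.1]
  · rw [heq c hc hca] at e'
    have : m ≤ α * m := abs_le.2 ⟨by nlinarith [hα.1], by nlinarith [hα.1]⟩
    linarith

/-- Some argument of maximum in-degree other than `a` keeps all its attackers. -/
theorem AF.TwoOfMaxInDegree.maxInDegree_deleteAttacks {F : AF U} (h : F.TwoOfMaxInDegree) {a : U}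
    {Z : Finset (U × U)} (hZ : Z ⊆ F.attacksOn a) :
    (F.deleteAttacks Z).maxInDegree = F.maxInDegree := by
  refine le_antisymm (F.maxInDegree_deleteAttacks_le Z) ?_
  obtain ⟨c, hc, hca⟩ := Finset.exists_mem_ne (Nat.lt_of_succ_le h) a
  obtain ⟨hc, hcard⟩ := Finset.mem_filter.1 hc
  rw [← hcard]
  refine le_trans (Finset.card_le_card fun b hb => ?_)
    ((F.deleteAttacks Z).card_attackers_le_maxInDegree (a := c) hc)
  exact AF.mem_attackers_deleteAttacks.2
    ⟨hb, fun hbZ => hca (AF.mem_attacksOn.1 (hZ hbZ)).2⟩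

/-- All coalitions share one normalisation factor, so `countingDegree_mono` applies; a smaller
factor after a deletion would give the remaining attacks more weight and could lower the degree. -/
theorem shapleyRegular_countingSemantics (α : Set.Ioo (0 : ℝ) 1) {F : AF U}
    (h : F.TwoOfMaxInDegree) : ShapleyRegular (countingSemantics U α) F where
  pos a ha := countingDegree_pos α.2 le_rfl ha
  top a ha := countingDegree_eq_one α.2 le_rfl ha <| Finset.eq_empty_of_forall_notMem fun b hb => by
    have := AF.mem_attackers_deleteAttacks.1 hb
    exact this.2 (AF.mem_attacksOn.2 ⟨AF.mem_attackers.1 this.1, rfl⟩)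
  mono a ha Z hZ e he := by
    have e1 := h.maxInDegree_deleteAttacks hZ
    have e2 := h.maxInDegree_deleteAttacks (Finset.insert_subset he hZ)
    simp only [countingSemantics]
    rw [e1, e2]
    refine countingDegree_mono (F := F.deleteAttacks Z) (F' := F.deleteAttacks (insert e Z)) α.2
      (by rw [e1]) (by rw [e2]) rfl ha (fun b hb => ?_) fun c _ hca => ?_
    · rw [AF.mem_attackers_deleteAttacks] at hb ⊢
      exact ⟨hb.1, fun h => hb.2 (Finset.mem_insert_of_mem h)⟩
    · ext b
      have : (b, c) ≠ e := fun h' => hca ((congrArg Prod.snd h').trans (AF.mem_attacksOn.1 he).2)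
      simp only [AF.mem_attackers_deleteAttacks, Finset.mem_insert, this, false_or]

theorem not_balancedImpact_impDVCounting [Infinite U] (α : Set.Ioo (0 : ℝ) 1) :
    ¬ BalancedImpact (impDVCounting (U := U) α) := by
  refine not_balancedImpact_of_deletionDiff (d := fun N => countingDegree α N)
    (g := fun N x => 1 - α * ((N : ℝ)⁻¹ * x)) (fun _ => rfl)
    (fun N F hN a ha h => countingDegree_eq_one α.2 (by exact_mod_cast hN) ha h)
    (fun N F hN a ha b h => ?_) fun N hN => ?_
  · rw [countingDegree_eq α.2 (by exact_mod_cast hN) ha, h, Finset.sum_singleton]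
  · have hN' : ((N : ℝ)⁻¹) ≠ 0 := inv_ne_zero (Nat.cast_ne_zero.2 hN)
    have hα : (α : ℝ) ≠ 0 := α.2.1.ne'
    refine ⟨fun x y hxy => ?_, by simp [hα, hN]⟩
    exact mul_left_cancel₀ hN' (mul_left_cancel₀ hα (sub_right_injective hxy))

/-! ### The impact of an unattacked single attacker -/

variable {F : AF U} {a b : U}

theorem impDVCounting_of_single_attacker (α : Set.Ioo (0 : ℝ) 1) (ha : a ∈ F.args)
    (hb : F.attackers b = ∅) (hab : F.attackers a = {b}) :
    impDVCounting α F {b} a = (countingSemantics U α).degree F a - 1 := by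
  have e : F.externalAttacks {b} = ∅ := by
    refine Finset.eq_empty_of_forall_notMem fun e he => ?_
    obtain ⟨h1, _, h3⟩ := AF.mem_externalAttacks.1 (show (e.1, e.2) ∈ _ from he)
    rw [Finset.mem_singleton.1 h3, ← AF.mem_attackers, hb] at h1
    simp at h1
  have hba : a ≠ b := by
    rintro rfl
    simp [hb] at hab
  rw [impDVCounting, deletionDiff, e, AF.deleteAttacks_empty,
    countingDegree_eq_one (F := F.deleteArgs a {b}) α.2
      (by exact_mod_cast F.maxInDegree_deleteArgs_le _ _) (mem_sdiff_sdiff_singleton_self ha)]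
  · rfl
  · ext x
    simp [AF.mem_attackers_deleteArgs, hab, hba]

/-- The attack `(b, a)` is the only path from `b` to `a`, and its Shapley measure has the empty
coalition as its only term. -/
theorem impSI_of_single_attacker {σ : GradualSemantics U} (ha : a ∈ F.args)
    (h1 : ∀ F : AF U, ∀ a ∈ F.args, F.attackers a = ∅ → σ.degree F a = 1)
    (hb : F.attackers b = ∅) (hab : F.attackers a = {b}) :
    impSI σ F {b} a = σ.degree F a - 1 := by
  have hba : b ≠ a := by
    rintro rfl
    simp [hb] at hab
  have hatt : (b, a) ∈ F.attacks := AF.mem_attackers.1 (by simp [hab])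
  -- The last attack of a path to `a` comes from `b`; in a path of length at least `2` the attack
  -- before it would hit `b`.
  have hn : ∀ n (p : F.Path b a n), n = 1 := fun n p => by
    match n, p with
    | 0, p => exact absurd (p.2.1.symm.trans p.2.2.1) hba
    | 1, _ => rfl
    | n + 2, p =>
      have e1 := AF.mem_attackers.2 (p.2.2.2 (Fin.last (n + 1)))
      rw [Fin.succ_last, p.2.2.1, hab, Finset.mem_singleton] at e1
      have e2 := AF.mem_attackers.2 (p.2.2.2 (Fin.last n).castSucc)
      rw [Fin.succ_castSucc, Fin.succ_last, e1, hb] at e2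
      simp at e2
  have s1 : shapley σ F b a = 1 - σ.degree F a := by
    have e : (F.attacksOn a).erase (b, a) = ∅ := by
      rw [AF.attacksOn_eq_image, hab]
      simp
    have h2 : σ.degree (F.deleteAttacks {(b, a)}) a = 1 := h1 _ a ha <| by
      ext x
      simp [AF.mem_attackers_deleteAttacks, hab]
    simp [shapley, e, hab, h2, AF.deleteAttacks_empty]
  have i1 : IsEmpty (EvenPath F b a) := ⟨fun p => by
    have h := p.1.2.1
    rw [hn _ p.2] at h
    exact Nat.not_even_one h⟩
  have hw : ∀ p : OddPath F b a, pathWeight σ F p.2 = shapley σ F b a := by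
    rintro ⟨⟨n, hodd⟩, p⟩
    obtain rfl : n = 1 := hn _ p
    rw [pathWeight, Fin.prod_univ_one]
    congr 1
    · exact p.2.1
    · exact p.2.2.1
  have i2 : Unique (OddPath F b a) :=
    { default := ⟨⟨1, odd_one⟩, AF.Path.cons hatt ⟨fun _ => a, rfl, rfl, fun i => i.elim0⟩⟩
      uniq := by
        rintro ⟨⟨n, hodd⟩, p⟩
        obtain rfl : n = 1 := hn _ p
        refine Sigma.ext rfl (heq_of_eq (Subtype.ext (funext fun i => ?_)))
        fin_cases i
        · exact p.2.1
        · exact p.2.2.1 }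
  rw [impSI, Finset.sum_singleton, impSISingle, tsum_empty, tsum_fintype, Fintype.sum_unique, hw, s1]
  ring

theorem countingSemantics_of_single_attacker (α : Set.Ioo (0 : ℝ) 1) (ha : a ∈ F.args)
    (hb : F.attackers b = ∅) (hab : F.attackers a = {b}) :
    (countingSemantics U α).degree F a = 1 - α * (F.maxInDegree : ℝ)⁻¹ := by
  have hbF : b ∈ F.args := F.attackers_subset a (by simp [hab])
  simp only [countingSemantics]
  rw [countingDegree_eq α.2 le_rfl ha, hab, Finset.sum_singleton,
    countingDegree_eq_one α.2 le_rfl hbF hb, mul_one]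

/-- The impact measure `I` gives an unattacked single attacker of `a` the impact that the counting
semantics suggests. -/
def CountsSingleAttacker (α : ℝ) (I : Impact U) : Prop :=
  ∀ (F : AF U) (a b : U), a ∈ F.args → F.attackers b = ∅ → F.attackers a = {b} →
    I F {b} a = -(α * (F.maxInDegree : ℝ)⁻¹)

theorem countsSingleAttacker_impDVCounting (α : Set.Ioo (0 : ℝ) 1) :
    CountsSingleAttacker α (impDVCounting (U := U) α) := fun F a b ha hb hab => by
  rw [impDVCounting_of_single_attacker α ha hb hab,
    countingSemantics_of_single_attacker α ha hb hab]
  ring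

theorem countsSingleAttacker_impSI (α : Set.Ioo (0 : ℝ) 1) :
    CountsSingleAttacker α (impSI (countingSemantics U α)) := fun F a b ha hb hab => by
  rw [impSI_of_single_attacker ha (fun F a ha h => countingDegree_eq_one α.2 le_rfl ha h) hb hab,
    countingSemantics_of_single_attacker α ha hb hab]
  ring

theorem CountsSingleAttacker.ne {α : ℝ} (hα : α ≠ 0) {I : Impact U}
    (hI : CountsSingleAttacker α I) {F F' : AF U} {a b : U} (ha : a ∈ F.args) (ha' : a ∈ F'.args)
    (hb : F.attackers b = ∅) (hab : F.attackers a = {b}) (hb' : F'.attackers b = ∅)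
    (hab' : F'.attackers a = {b}) (hN : F.maxInDegree < F'.maxInDegree) :
    I F {b} a ≠ I F' {b} a := by
  rw [hI F a b ha hb hab, hI F' a b ha' hb' hab']
  intro h
  have := mul_left_cancel₀ hα (neg_injective h)
  exact hN.ne (by exact_mod_cast inv_injective this)

/-! ### Frameworks in which a remote attack changes the normalisation factor -/

variable [Infinite U]

theorem CountsSingleAttacker.not_impactIndependence {α : ℝ} (hα : α ≠ 0) {I : Impact U}
    (hI : CountsSingleAttacker α I) : ¬ ImpactIndependence I := by
  obtain ⟨u, hu⟩ : ∃ u : ℕ → U, Function.Injective u :=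
    ⟨_, (Infinite.natEmbedding U).injective⟩
  have hne : ∀ i j, u i = u j ↔ i = j := fun i j => hu.eq_iff
  let F : AF U :=
    { args := {u 0, u 1}
      attacks := {(u 1, u 0)}
      left_mem := by simp
      right_mem := by simp }
  -- The self-attack gives `u 3` two attackers, so the union has a larger normalisation factor than
  -- `F`, whose maximum in-degree is at most `1`.
  let F' : AF U :=
    { args := {u 2, u 3}
      attacks := {(u 2, u 3), (u 3, u 3)}
      left_mem := by simp
      right_mem := by simp }
  have att : ∀ x y, x ∈ F.attackers y ↔ x = u 1 ∧ y = u 0 := fun x y => by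
    simp [AF.mem_attackers, F]
  have att' : ∀ x y, x ∈ (F.union F').attackers y ↔
      x = u 1 ∧ y = u 0 ∨ x = u 2 ∧ y = u 3 ∨ x = u 3 ∧ y = u 3 := fun x y => by
    simp only [AF.mem_attackers, AF.union, F, F', Finset.mem_union, Finset.mem_insert,
      Finset.mem_singleton, Prod.mk.injEq]
  intro h
  refine hI.ne hα (F := F) (F' := F.union F') (a := u 0) (b := u 1) (by simp [F])
    (by simp [F, AF.union]) ?_ ?_ ?_ ?_ ?_
    (h F F' (by simp [F, F', hne]) {u 1} (by simp [F]) (u 0) (by simp [F]))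
  · ext x; simp [att, hne]
  · ext x; simp [att]
  · ext x; simp [att', hne]
  · ext x; simp [att', hne]
  · have h1 : F.maxInDegree ≤ 1 := Finset.sup_le fun c _ =>
      Finset.card_le_one.2 fun x hx y hy => by
        rw [((att x c).1 hx).1, ((att y c).1 hy).1]
    have h2 := (F.union F').card_attackers_le_maxInDegree (a := u 3) (by simp [AF.union, F'])
    have h3 : 1 < ((F.union F').attackers (u 3)).card :=
      Finset.one_lt_card.2 ⟨u 2, by simp [att'], u 3, by simp [att'], by simp [hne]⟩
    omega

theorem CountsSingleAttacker.not_impactDirectionality {α : ℝ} (hα : α ≠ 0) {I : Impact U}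
    (hI : CountsSingleAttacker α I) : ¬ ImpactDirectionality I := by
  obtain ⟨u, hu⟩ : ∃ u : ℕ → U, Function.Injective u :=
    ⟨_, (Infinite.natEmbedding U).injective⟩
  have hne : ∀ i j, u i = u j ↔ i = j := fun i j => hu.eq_iff
  let F : AF U :=
    { args := {u 0, u 1, u 2}
      attacks := {(u 1, u 0), (u 1, u 2)}
      left_mem := by simp
      right_mem := by simp }
  have h2F : u 2 ∈ F.args := by simp [F]
  -- The attacked argument `u 2` has no path to `u 0`, and its new self-attack gives it a second
  -- attacker, which raises the normalisation factor.
  let F' := F.addAttack (u 2) (u 2) h2F h2F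
  have att : ∀ x y, x ∈ F.attackers y ↔ x = u 1 ∧ y = u 0 ∨ x = u 1 ∧ y = u 2 := fun x y => by
    simp [AF.mem_attackers, F]
  have att' : ∀ x y, x ∈ F'.attackers y ↔
      x = u 2 ∧ y = u 2 ∨ x = u 1 ∧ y = u 0 ∨ x = u 1 ∧ y = u 2 := fun x y => by
    simp [AF.mem_attackers, AF.addAttack, F, F']
  have hp : ¬ F.HasPath (u 2) (u 0) := by
    refine AF.not_hasPath_of_closed (S := {u 0, u 1}) (fun c _ x hx => ?_) (by simp)
      (by simp [hne])
    rcases (att x c).1 hx with h | h <;> simp [h.1]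
  intro h
  refine hI.ne hα (F := F) (F' := F') (a := u 0) (b := u 1) (by simp [F])
    (by simp [F, F', AF.addAttack]) ?_ ?_ ?_ ?_ ?_
    (h F (u 2) (u 2) h2F h2F (u 0) (by simp [F]) hp {u 1} (by simp [F]))
  · ext x; simp [att, hne]
  · ext x; simp [att, hne]
  · ext x; simp [att', hne]
  · ext x; simp [att', hne]
  · have h1 : F.maxInDegree ≤ 1 := Finset.sup_le fun c _ =>
      Finset.card_le_one.2 fun x hx y hy => by
        rcases (att x c).1 hx with hx | hx <;> rcases (att y c).1 hy with hy | hy <;>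
          rw [hx.1, hy.1]
    have h2 := F'.card_attackers_le_maxInDegree (a := u 2) h2F
    have h3 : 1 < (F'.attackers (u 2)).card :=
      Finset.one_lt_card.2 ⟨u 2, by simp [att'], u 1, by simp [att'], by simp [hne]⟩
    omega

end CountingModel

/-! ### The theorem -/

theorem mainTheorem1 {U : Type*} [DecidableEq U] [Infinite U] (α : Set.Ioo (0 : ℝ) 1) :
    -- h-categoriser, max-based and card-based semantics
    (∀ σ : GradualSemantics U, (σ = hCategoriser U ∨ σ = maxBased U ∨ σ = cardBased U) →
      -- the impact `ImpSI` is given by convergent sums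
      (∀ F : AF U, PathSummable σ F) ∧
      -- `ImpSI`
      (ImpactAnonymity (impSI σ) ∧
        ImpactIndependence (impSI σ) ∧
        BalancedImpact (impSI σ) ∧
        VoidImpact (impSI σ) ∧
        ImpactDirectionality (impSI σ) ∧
        ImpactMinimisation (impSI σ) ∧
        ZeroImpact (impSI σ) ∧
        ImpactSymmetry (impSI σ) ∧
        ImpactExistence σ (impSI σ)) ∧
      -- `ImpDV`
      (ImpactAnonymity (impDV σ) ∧
        ImpactIndependence (impDV σ) ∧
        ¬ BalancedImpact (impDV σ) ∧
        VoidImpact (impDV σ) ∧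
        ImpactDirectionality (impDV σ) ∧
        ImpactMinimisation (impDV σ) ∧
        ZeroImpact (impDV σ) ∧
        ImpactSymmetry (impDV σ) ∧
        ImpactExistence σ (impDV σ))) ∧
    -- counting semantics
    (∀ σ : GradualSemantics U, σ = countingSemantics U α →
      -- `ImpSI`
      (ImpactAnonymity (impSI σ) ∧
        ¬ ImpactIndependence (impSI σ) ∧
        BalancedImpact (impSI σ) ∧
        VoidImpact (impSI σ) ∧
        ¬ ImpactDirectionality (impSI σ) ∧
        ImpactMinimisation (impSI σ) ∧
        ZeroImpact (impSI σ) ∧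
        ImpactSymmetry (impSI σ) ∧
        (∀ F : AF U, F.TwoOfMaxInDegree → PathSummable σ F) ∧
        ImpactExistenceOn AF.TwoOfMaxInDegree σ (impSI σ)) ∧
      -- `ImpDV`
      (ImpactAnonymity (impDVCounting (U := U) α) ∧
        ¬ ImpactIndependence (impDVCounting (U := U) α) ∧
        ¬ BalancedImpact (impDVCounting (U := U) α) ∧
        VoidImpact (impDVCounting (U := U) α) ∧
        ¬ ImpactDirectionality (impDVCounting (U := U) α) ∧
        ImpactMinimisation (impDVCounting (U := U) α) ∧
        ZeroImpact (impDVCounting (U := U) α) ∧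
        ImpactSymmetry (impDVCounting (U := U) α) ∧
        ImpactExistence σ (impDVCounting (U := U) α))) := by
  have agg : ∀ σ : GradualSemantics U, (σ = hCategoriser U ∨ σ = maxBased U ∨ σ = cardBased U) →
      ∃ H : Finset U → (U → ℝ) → ℝ, IsAggregator H ∧ IsAggregatedBy σ H ∧
        ∃ κ : ℝ, 0 ≤ κ ∧ ∀ b v, H {b} v = κ + v b := by
    rintro σ (rfl | rfl | rfl)
    · exact ⟨_, isAggregator_sum, isAggregatedBy_hCategoriser, 0, le_rfl, by simp⟩
    · refine ⟨_, isAggregator_max, isAggregatedBy_maxBased, 0, le_rfl, fun b v => ?_⟩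
      have : Unique {c // c ∈ ({b} : Finset U)} :=
        ⟨⟨⟨b, Finset.mem_singleton_self b⟩⟩, fun c => Subtype.ext (Finset.mem_singleton.1 c.2)⟩
      rw [ciSup_unique, zero_add]
      exact congrArg v (Finset.mem_singleton.1 (default : {c // c ∈ ({b} : Finset U)}).2)
    · exact ⟨_, isAggregator_card, isAggregatedBy_cardBased, 1, zero_le_one, by simp⟩
  refine ⟨fun σ hσ => ?_, ?_⟩
  · obtain ⟨H, hH, hσH, κ, hκ, hs⟩ := agg σ hσ
    have hloc := hσH.localDegree hH
    have hI : ∀ F, impDV σ F = deletionDiff ((fun _ => σ.degree) F.maxInDegree) F := fun _ => rfl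
    have hmin := impactMinimisation_of_deletionDiff hI fun _ => hloc
    have hvoid : VoidImpact (impDV σ) := fun F a _ => deletionDiff_empty _ F a
    exact ⟨fun F => (hσH.shapleyRegular hH F).pathSummable,
      ⟨impactAnonymity_impSI hloc.upToMax, impactIndependence_impSI hloc, balancedImpact_impSI σ,
        voidImpact_impSI σ, impactDirectionality_impSI hloc, impactMinimisation_impSI σ,
        zeroImpact_impSI σ, impactSymmetry_impSI hloc.upToMax,
        impactExistenceOn_impSI fun F _ => hσH.shapleyRegular hH F⟩,
      impactAnonymity_of_deletionDiff hI fun _ => hloc, impactIndependence_impDV hloc,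
      not_balancedImpact_impDV hσH hH hκ hs, hvoid, impactDirectionality_impDV hloc, hmin,
      zeroImpact_of_minimisation hvoid hmin, impactSymmetry_of_deletionDiff hI fun _ => hloc,
      impactExistence_of_deletionDiff (d := fun _ => σ.degree) hI (fun _ => rfl)
        fun _ F _ a ha h => hσH.degree_eq_one hH ha h⟩
  · rintro σ rfl
    have hloc := localDegreeUpToMax_countingSemantics (U := U) α
    have hα : (α : ℝ) ≠ 0 := α.2.1.ne'
    have hI : ∀ F : AF U, impDVCounting α F =
        deletionDiff ((fun N : ℕ => countingDegree α N) F.maxInDegree) F := fun _ => rfl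
    have hd : ∀ N : ℕ, LocalDegree (countingDegree α N : AF U → U → ℝ) := fun N =>
      localDegree_countingDegree α N
    have hmin := impactMinimisation_of_deletionDiff hI hd
    have hvoid : VoidImpact (impDVCounting (U := U) α) := fun F a _ => deletionDiff_empty _ F a
    have hSI := countsSingleAttacker_impSI (U := U) α
    have hDV := countsSingleAttacker_impDVCounting (U := U) α
    exact ⟨⟨impactAnonymity_impSI hloc, hSI.not_impactIndependence hα, balancedImpact_impSI _,
        voidImpact_impSI _, hSI.not_impactDirectionality hα, impactMinimisation_impSI _,
        zeroImpact_impSI _, impactSymmetry_impSI hloc,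
        fun F hF => (shapleyRegular_countingSemantics α hF).pathSummable,
        impactExistenceOn_impSI fun F hF => shapleyRegular_countingSemantics α hF⟩,
      impactAnonymity_of_deletionDiff hI hd, hDV.not_impactIndependence hα,
      not_balancedImpact_impDVCounting α, hvoid, hDV.not_impactDirectionality hα, hmin,
      zeroImpact_of_minimisation hvoid hmin, impactSymmetry_of_deletionDiff hI hd,
      impactExistence_of_deletionDiff (d := fun N => countingDegree α N) hI (fun _ => rfl)
        fun N F hN a ha h => countingDegree_eq_one α.2 (by exact_mod_cast hN) ha h⟩
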